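/- A point $p\in\mathbb{R}^2$ \emph{dominates} a point $q\neq p$ if $p_x\ge q_x$ and $p_y\ge q_y$. Let $P$ be a finite set of $n$ points in the plane in general position (no two points share an $x$- or $y$-coordinate, no three are collinear). Its Pareto front consists of the points of $P$ that no other point of $P$ dominates. An input is an array $I$ of length $n$ that stores each point of $P$ once. A correct output for $I$ consists of a \emph{front list} $(f_1,\dots,f_k)$ such that $I[f_1],\dots,I[f_k]$ are precisely the points of the Pareto front, by increasing $x$-coordinate, and a \emph{witness list} $(w_1,\dots,w_n)$ with $w_i=-1$ if $I[i]$ is on the front, and otherwise such that $I[w_i]$ is a point that dominates $I[i]$. A \emph{region set} $R$ is a set of pairwise disjoint axis-aligned rectangles. The \emph{universe} $(P,R)$ is the set $\mathbb{I}_{P,R}$ of all inputs $I$ storing $P$ such that for each $r\in R$ the points of $P\cap r$ appear in $I$ in increasing or decreasing order, by $x$-coordinate or by $y$-coordinate. A \emph{comparison-based algorithm} for inputs of size $n$ accesses the points only through binary tests on which it branches; its running time on $I$ is the number of elementary operations it executes, where each test, each appending of an index to the front list, each writing of a witness, each other elementary step, and halting count one. For a universe $(P,R)$ let $\mathrm{Universal}(\mathcal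 A,(P,R))=\max_{I\in\mathbb{I}_{P,R}}\mathrm{Runtime}(\mathcal A,I)$. Let $\mathcal A$ be the following recursive algorithm of Eppstein, Goodrich, Illickan and To, which uses only comparisons of the $x$- or of the $y$-coordinates of two points. On a subsequence $I'$ of the input: if $I'$ is sorted (by $x$ or $y$, increasingly or decreasingly), output its Pareto front and a witness for each of its other points by a linear-time sweep. Otherwise let $m$ be the median of the $x$-coordinates in $I'$, found by deterministic linear-time selection (median of medians), and let $q$ be the highest point $p$ of $I'$ with $p_x\ge m$; let $I_1$ and $I_2$ be the subsequences of the $p$ in $I'$ with $p_y>q_y$ and with $p_x>q_x$, respectively; give all points other than $q$ that are in neither of them the witness $q$; recurse on $I_1$, append $q$ to the front list, and recurse on $I_2$. \textbf{Theorem.} $\mathcal A$ gives a correct output on every input whose points are in general position, and $\mathcal A$ is universally optimal: there is a constant $c>0$ such that for every universe $(P,R)$ and every comparison-based algorithm $\mathcal A'$ that gives a correct output on every input in $\mathbb{I}_{P,R}$ (possibly tailor-made for $(P,R)$, and possibly using arbitrary binary tests of the input), $$\mathrm{Universal}(\mathcal A,(P,R))\le c\cdot \mathrm{Universal}(\mathcal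 A',(P,R)).$$ -/

import Mathlib

namespace ParetoFront

/-! ### Points, dominance, general position -/

/-- Points of the plane; `p.1` is the x-coordinate and `p.2` the y-coordinate. -/
abbrev Point : Type := ℝ × ℝ

/-- An input of size `n`: an array of `n` points. -/
abbrev Input (n : ℕ) : Type := Fin n → Point

/-- `p` dominates the other point `q`. -/
def Dominates (p q : Point) : Prop := p ≠ q ∧ q.1 ≤ p.1 ∧ q.2 ≤ p.2

/-- No two points have the same x- or y-coordinate and no three points lie on a line. -/
def GeneralPosition (P : Set Point) : Prop :=
  (∀ p ∈ P, ∀ q ∈ P, p ≠ q → p.1 ≠ q.1 ∧ p.2 ≠ q.2) ∧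
  (∀ p ∈ P, ∀ q ∈ P, ∀ r ∈ P, p ≠ q → q ≠ r → p ≠ r → ¬ Collinear ℝ ({p, q, r} : Set Point))

/-- The Pareto front: the points of `P` that are dominated by no other point of `P`. -/
def paretoFront (P : Set Point) : Set Point := {p ∈ P | ∀ q ∈ P, ¬ Dominates q p}

/-! ### The output -/

/-- An output: a front list of indices, and a witness array
(`none` stands for "no witness", the entry `-1`). -/
structure Output (n : ℕ) where
  front : List (Fin n)
  witness : Fin n → Option (Fin n)

/-- The output before anything has been written. -/
def Output.blank (n : ℕ) : Output n := ⟨[], fun _ => none⟩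

/-- `F` is the front list of `I`: the points `I[f]`, `f ∈ F`, are precisely the points of the
Pareto front, listed by increasing x-coordinate. -/
def IsFrontList {n : ℕ} (I : Input n) (F : List (Fin n)) : Prop :=
  (∀ p, p ∈ F.map I ↔ p ∈ paretoFront (Set.range I)) ∧
  F.Pairwise (fun i j => (I i).1 < (I j).1)

/-- `W` is a witness list for `I`. -/
def IsWitnessList {n : ℕ} (I : Input n) (W : Fin n → Option (Fin n)) : Prop :=
  ∀ i, (I i ∈ paretoFront (Set.range I) → W i = none) ∧
    (I i ∉ paretoFront (Set.range I) → ∃ j, W i = some j ∧ Dominates (I j) (I i))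

/-- The output is correct for the input `I`. -/
def IsSolution {n : ℕ} (I : Input n) (o : Output n) : Prop :=
  IsFrontList I o.front ∧ IsWitnessList I o.witness

/-! ### Universes -/

/-- An axis-aligned rectangle: a product of two intervals (with or without their end points). -/
def IsRectangle (r : Set Point) : Prop :=
  ∃ s t : Set ℝ, s.OrdConnected ∧ t.OrdConnected ∧ r = s ×ˢ t

/-- A region set: a set of pairwise disjoint axis-aligned rectangles. -/
def IsRegionSet (R : Set (Set Point)) : Prop :=
  (∀ r ∈ R, IsRectangle r) ∧ R.PairwiseDisjoint id

/-- The points of `I` in every region of `R` appear in `I` in increasing or decreasing order,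
by x-coordinate or by y-coordinate. -/
def Respects {n : ℕ} (I : Input n) (R : Set (Set Point)) : Prop :=
  ∀ r ∈ R,
    StrictMonoOn (fun i => (I i).1) (I ⁻¹' r) ∨ StrictAntiOn (fun i => (I i).1) (I ⁻¹' r) ∨
    StrictMonoOn (fun i => (I i).2) (I ⁻¹' r) ∨ StrictAntiOn (fun i => (I i).2) (I ⁻¹' r)

/-- The universe `(P, R)`: all arrays that store the points of `P`, each of them once,
and that respect `R`. -/
def universeInputs (P : Finset Point) (R : Set (Set Point)) : Set (Input P.card) :=
  {I | Function.Injective I ∧ Set.range I = (P : Set Point) ∧ Respects I R}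

/-! ### Comparison-based algorithms and their running time -/

/-- Comparison-based programs on inputs of size `n`. The input is accessed only through binary
tests, taken from a type `T`, on whose outcome the program branches. The other elementary
operations are: appending an index to the front list, writing an entry of the witness array, and
an elementary step (`step`) that touches neither the points nor the output. -/
inductive Prog (T : Type) (n : ℕ) (α : Type) : Type where
  | ret (a : α) : Prog T n α
  | test (t : T) (next : Bool → Prog T n α) : Prog T n α
  | step (next : Prog T n α) : Prog T n α
  | pushFront (i : Fin n) (next : Prog T n α) : Prog T n α
  | setWitness (i j : Fin n) (next : Prog T n α) : Prog T n α

namespace Prog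

variable {T : Type} {n : ℕ} {α β : Type}

/-- Sequential composition. -/
def bind : Prog T n α → (α → Prog T n β) → Prog T n β
  | ret a, f => f a
  | test t k, f => test t (fun b => (k b).bind f)
  | step k, f => step (k.bind f)
  | pushFront i k, f => pushFront i (k.bind f)
  | setWitness i j k, f => setWitness i j (k.bind f)

instance : Monad (Prog T n) where
  pure := ret
  bind := bind

/-- The value returned when the tests are answered by `ans`. -/
def value (ans : T → Bool) : Prog T n α → α
  | ret a => a
  | test t k => (k (ans t)).value ans
  | step k => k.value ans
  | pushFront _ k => k.value ans
  | setWitness _ _ k => k.value ans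

/-- The number of elementary operations (tests, steps and writes) that are executed when the
tests are answered by `ans`. -/
def cost (ans : T → Bool) : Prog T n α → ℕ
  | ret _ => 0
  | test t k => (k (ans t)).cost ans + 1
  | step k => k.cost ans + 1
  | pushFront _ k => k.cost ans + 1
  | setWitness _ _ k => k.cost ans + 1

/-- The effect of the executed writes on the output. -/
def write (ans : T → Bool) : Prog T n α → Output n → Output n
  | ret _, o => o
  | test t k, o => (k (ans t)).write ans o
  | step k, o => k.write ans o
  | pushFront i k, o => k.write ans { o with front := o.front ++ [i] }
  | setWitness i j k, o => k.write ans { o with witness := Function.update o.witness i (some j) }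

/-- The output of a program. -/
def output (ans : T → Bool) (A : Prog T n α) : Output n := A.write ans (Output.blank n)

/-- The running time of a program: all elementary operations, and one for halting. -/
def runtime (ans : T → Bool) (A : Prog T n α) : ℕ := A.cost ans + 1

end Prog

/-- `Universal(A, (P, R))`: the maximum running time of `A` over all inputs of the universe, where
`eval I t` is the outcome of the test `t` on the input `I`. -/
noncomputable def universalTime (P : Finset Point) (R : Set (Set Point)) {T : Type}
    (eval : Input P.card → T → Bool) (A : Prog T P.card Unit) : ℕ∞ :=
  ⨆ I ∈ universeInputs P R, (A.runtime (eval I) : ℕ∞)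

/-- Comparisons of the coordinates of two input points. -/
inductive CoordTest (n : ℕ) : Type where
  | x (i j : Fin n) : CoordTest n
  | y (i j : Fin n) : CoordTest n

/-- The outcome of a coordinate comparison: is `I[i].x < I[j].x`, is `I[i].y < I[j].y`. -/
noncomputable def CoordTest.eval {n : ℕ} (I : Input n) : CoordTest n → Bool
  | x i j => decide ((I i).1 < (I j).1)
  | y i j => decide ((I i).2 < (I j).2)

/-- An algorithm that compares coordinates: a program for every input size. -/
abbrev CoordAlgorithm : Type := ∀ n : ℕ, Prog (CoordTest n) n Unit

/-- The algorithm outputs the front list and a witness list for every input in general position. -/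
def CoordAlgorithm.Correct (A : CoordAlgorithm) : Prop :=
  ∀ (n : ℕ) (I : Input n), Function.Injective I → GeneralPosition (Set.range I) →
    IsSolution I ((A n).output (CoordTest.eval I))

/-- Universal optimality: one constant `c` such that on every universe `(P, R)` the algorithm is
at most `c` times slower than any algorithm `B` that is correct on that universe. The competitor
may be tailor-made for the universe, and it may use any kind `T` of binary tests of the input:
coordinate comparisons, orientation tests, or others. -/
def CoordAlgorithm.UniversallyOptimal (A : CoordAlgorithm) : Prop :=
  ∃ c : ℕ, 0 < c ∧
    ∀ (P : Finset Point) (R : Set (Set Point)), GeneralPosition (P : Set Point) → IsRegionSet R →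
      ∀ (T : Type) (eval : Input P.card → T → Bool) (B : Prog T P.card Unit),
        (∀ I ∈ universeInputs P R, IsSolution I (B.output (eval I))) →
        universalTime P R CoordTest.eval (A P.card) ≤ c * universalTime P R eval B

/-! ### The algorithm of Eppstein, Goodrich, Illickan and To

Lists of points are lists of indices into the input array. Every call of one of the functions
below executes an elementary step, in addition to its tests and its writes to the output. -/

/-- The programs from which the algorithm is built. -/
abbrev CProg (n : ℕ) (α : Type) : Type := Prog (CoordTest n) n α

section Algorithm

variable {n : ℕ}

/-- Ask a comparison. -/
def ask (t : CoordTest n) : CProg n Bool := Prog.test t Prog.ret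

/-- One elementary step. -/
def tick : CProg n Unit := Prog.step (Prog.ret ())

/-- Append to the front list. -/
def addFront (i : Fin n) : CProg n Unit := Prog.pushFront i (Prog.ret ())

/-- Write `j` as the witness of `i`. -/
def addWitness (i j : Fin n) : CProg n Unit := Prog.setWitness i j (Prog.ret ())

/-- `count l a` is `a` plus the length of `l`. -/
def count : List (Fin n) → ℕ → CProg n ℕ
  | [], a => do tick; pure a
  | _ :: l, a => do tick; count l (a + 1)

/-- `rev l acc` is the reversal of `l` followed by `acc`. -/
def rev : List (Fin n) → List (Fin n) → CProg n (List (Fin n))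
  | [], acc => do tick; pure acc
  | i :: l, acc => do tick; rev l (i :: acc)

/-- The `k`-th entry of a list, counted from zero. -/
def nth : List (Fin n) → ℕ → CProg n (Option (Fin n))
  | [], _ => do tick; pure none
  | i :: _, 0 => do tick; pure (some i)
  | _ :: l, k + 1 => do tick; nth l k

/-- The sublist of the entries that pass the test, in the same order. -/
def select (t : Fin n → CoordTest n) : List (Fin n) → CProg n (List (Fin n))
  | [] => do tick; pure []
  | i :: l => do
    tick
    let b ← ask (t i)
    let l' ← select t l
    pure (if b then i :: l' else l')

/-- Are the entries in strictly increasing order with respect to the comparison `lt`? -/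
def isSorted (lt : Fin n → Fin n → CoordTest n) : List (Fin n) → CProg n Bool
  | [] => do tick; pure true
  | [_] => do tick; pure true
  | i :: j :: l => do
    tick
    if ← ask (lt i j) then isSorted lt (j :: l) else pure false

/-- Insert `i` into a list that is sorted by x-coordinate. -/
def insertX (i : Fin n) : List (Fin n) → CProg n (List (Fin n))
  | [] => do tick; pure [i]
  | j :: l => do
    tick
    if ← ask (.x i j) then pure (i :: j :: l)
    else
      let l' ← insertX i l
      pure (j :: l')

/-- Insertion sort by x-coordinate; only used on lists of at most fifty points. -/
def sortX : List (Fin n) → CProg n (List (Fin n))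
  | [] => do tick; pure []
  | i :: l => do
    tick
    let l' ← sortX l
    insertX i l'

/-- The medians by x-coordinate of consecutive groups of five points (a shorter last group is
ignored). -/
def groupMedians : List (Fin n) → CProg n (List (Fin n))
  | a :: b :: c :: d :: e :: l => do
    tick
    let s ← sortX [a, b, c, d, e]
    let m ← nth s 2
    let ms ← groupMedians l
    match m with
    | none => pure ms
    | some m => pure (m :: ms)
  | _ => do tick; pure []

/-- Deterministic linear-time selection (median of medians): the point of the list that has
exactly `k` points with smaller x-coordinate. The first argument bounds the depth of the
recursion; the length of the list suffices. -/
def selectRank : ℕ → List (Fin n) → ℕ → CProg n (Option (Fin n))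
  | 0, _, _ => do tick; pure none
  | fuel + 1, l, k => do
    tick
    let len ← count l 0
    if len ≤ 50 then
      let s ← sortX l
      nth s k
    else
      let ms ← groupMedians l
      let g ← count ms 0
      let pivot ← selectRank fuel ms (g / 2)
      match pivot with
      | none => pure none
      | some p =>
        let lo ← select (fun i => .x i p) l
        let hi ← select (fun i => .x p i) l
        let a ← count lo 0
        if k < a then selectRank fuel lo k
        else if k = a then pure (some p)
        else selectRank fuel hi (k - a - 1)

/-- Sweep over points that are sorted decreasingly by one coordinate; `lt` compares the other
coordinate, `b` is the last point found on the front, and `acc` holds the earlier ones, the latest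
first. A point that is not on the front gets the witness `b`. The points of the front are
returned, the latest first. -/
def sweep (lt : Fin n → Fin n → CoordTest n) (b : Fin n) (acc : List (Fin n)) :
    List (Fin n) → CProg n (List (Fin n))
  | [] => do tick; pure (b :: acc)
  | i :: l => do
    tick
    if ← ask (lt b i) then sweep lt i (b :: acc) l
    else
      addWitness i b
      sweep lt b acc l

/-- The sweep, started at the first point of the list. -/
def sweepAll (lt : Fin n → Fin n → CoordTest n) : List (Fin n) → CProg n (List (Fin n))
  | [] => do tick; pure []
  | b :: l => do tick; sweep lt b [] l

/-- Append all entries of a list to the front list. -/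
def emit : List (Fin n) → CProg n Unit
  | [] => tick
  | i :: l => do tick; addFront i; emit l

/-- If the list is sorted, by x or y, increasingly or decreasingly, then output its Pareto front
and the witnesses of its other points in linear time and return `true`; otherwise return
`false`. -/
def trySorted (l : List (Fin n)) : CProg n Bool := do
  tick
  if ← isSorted (fun i j => .x i j) l then
    let r ← rev l []
    let f ← sweepAll .y r
    emit f
    pure true
  else if ← isSorted (fun i j => .x j i) l then
    let f ← sweepAll .y l
    emit f
    pure true
  else if ← isSorted (fun i j => .y i j) l then
    let r ← rev l []
    let f ← sweepAll .x r
    let f' ← rev f []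
    emit f'
    pure true
  else if ← isSorted (fun i j => .y j i) l then
    let f ← sweepAll .x l
    let f' ← rev f []
    emit f'
    pure true
  else pure false

/-- The representative: the highest point among `q` and the points `i` of the list with
`I[i].x ≥ I[m].x`. -/
def representative (m : Fin n) (q : Fin n) : List (Fin n) → CProg n (Fin n)
  | [] => do tick; pure q
  | i :: l => do
    tick
    if ← ask (.x i m) then representative m q l
    else if ← ask (.y q i) then representative m i l
    else representative m q l

/-- Give the witness `q` to all points of the list, other than `q`, that are neither above `q` nor
to the right of `q`. -/
def discard (q : Fin n) : List (Fin n) → CProg n Unit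
  | [] => tick
  | i :: l => do
    tick
    if ← ask (.y q i) then discard q l
    else if ← ask (.x q i) then discard q l
    else if i = q then discard q l
    else
      addWitness i q
      discard q l

/-- The recursive algorithm on a sublist of the input. The first argument bounds the depth of the
recursion; the length of the list suffices. -/
def paretoRec : ℕ → List (Fin n) → CProg n Unit
  | 0, _ => tick
  | fuel + 1, l => do
    tick
    if ← trySorted l then pure ()
    else
      let len ← count l 0
      let median ← selectRank len l (len / 2)
      match median with
      | none => pure ()
      | some m =>
        let q ← representative m m l
        let l₁ ← select (fun i => .y q i) l
        let l₂ ← select (fun i => .x q i) l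
        discard q l
        paretoRec fuel l₁
        addFront q
        paretoRec fuel l₂

/-- Read the input: the list of the first `k` indices of the array, put in front of `acc`, at one
step per index. -/
def readInput : (k : ℕ) → k ≤ n → List (Fin n) → CProg n (List (Fin n))
  | 0, _, acc => do tick; pure acc
  | k + 1, h, acc => do tick; readInput k (Nat.le_of_succ_le h) (⟨k, h⟩ :: acc)

end Algorithm

/-- The Pareto-front algorithm of Eppstein, Goodrich, Illickan and To. -/
def eppsteinGoodrichIllickanTo : CoordAlgorithm := fun n => do
  let l ← readInput n le_rfl []
  paretoRec n l

end ParetoFront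

/-! Correctness is an induction on the recursion. Points above the representative `q` lie to its
left and points to its right lie below it, so no point of one subproblem is dominated from outside
it, `q` itself is undominated, and `q` dominates everything else.

For optimality, put two points in the same class if they share a region; points outside all regions
are classes of their own. The recursion tree depends only on the point set, not on the input order.
A node whose points all belong to one class is sorted in every input of the universe, so recursion
stops there. Up to a linear term, the running time is therefore bounded by the total size of the
mixed nodes, that is, by n plus D, where D is the sum over the points of the depth of their deepest
mixed node (`cost_paretoRec_le`, `mixedSize_le`).

It remains to show that D = O(t + n) for any correct program with running time at most t
(`sum_length_address_le`). Only inputs sorted by x inside every class are used. There are at least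
n!/M of them, where M is the product over all points p of the size of the class of p
(`factorial_le_card_sortedInputs`), and they produce at most 2^t outputs
(`Prog.card_image_write_le`). If several inputs have the same output, then following the witnesses
from a position i leads to a front point f that dominates or equals the i-th point in all of them
(`exists_common_dominator`). Nodes are closed upwards, so the deepest mixed node of the i-th point
is one of the nodes containing f, and these form a single branch whose sizes halve at each level.

To count, colour each point by its class and the address of its deepest mixed node, and give a
colour of depth d with s points the weight (3/2)^d s/n. The colours possible at a fixed position
have total weight at most 4, and the classes alone determine a sorted input, so the inputs with a
common output number at most 4^n/W, where W is the product of the weights over all points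
(`card_mul_prod_weight_le`). On the other side, the nodes of one level form a descending staircase,
so at most two mixed nodes per level meet a given rectangle: a third one between them would lie
inside the rectangle and not be mixed (`card_addresses_le_two`). Hence splitting classes into
colours loses only a factor exp(O(n)) against (4/3)^D (`sum_ratio_le`). Since (3/2)(3/4) = 9/8 > 1,
the comparison gives (9/8)^D ≤ 2^t exp(O(n)). Finally n is at most the cost of the program, because
every index must be written. -/

namespace ParetoFront

/-! ### Running the basic programs -/

namespace Prog

variable {T : Type} {n : ℕ} {α β : Type} (ans : T → Bool)

@[simp] theorem value_pure (a : α) : (pure a : Prog T n α).value ans = a := rfl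

@[simp] theorem cost_pure (a : α) : (pure a : Prog T n α).cost ans = 0 := rfl

@[simp] theorem write_pure (a : α) (o : Output n) :
    (pure a : Prog T n α).write ans o = o := rfl

@[simp] theorem value_bind (A : Prog T n α) (f : α → Prog T n β) :
    (A >>= f).value ans = (f (A.value ans)).value ans := by
  change (A.bind f).value ans = _
  induction A with
  | ret a => rfl
  | test t k ih => exact ih _
  | step k ih => exact ih
  | pushFront i k ih => exact ih
  | setWitness i j k ih => exact ih

@[simp] theorem cost_bind (A : Prog T n α) (f : α → Prog T n β) :
    (A >>= f).cost ans = A.cost ans + (f (A.value ans)).cost ans := by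
  change (A.bind f).cost ans = _
  induction A with
  | ret a => simp [bind, cost, value]
  | test t k ih => simp only [bind, cost, value, ih]; omega
  | step k ih => simp only [bind, cost, value, ih]; omega
  | pushFront i k ih => simp only [bind, cost, value, ih]; omega
  | setWitness i j k ih => simp only [bind, cost, value, ih]; omega

@[simp] theorem write_bind (A : Prog T n α) (f : α → Prog T n β) (o : Output n) :
    (A >>= f).write ans o = (f (A.value ans)).write ans (A.write ans o) := by
  change (A.bind f).write ans o = _
  induction A generalizing o with
  | ret a => rfl
  | test t k ih => exact ih _ _
  | step k ih => exact ih _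
  | pushFront i k ih => exact ih _
  | setWitness i j k ih => exact ih _

end Prog

section Programs

variable {n : ℕ} (ans : CoordTest n → Bool)

@[simp] theorem value_ask (t : CoordTest n) : (ask t).value ans = ans t := rfl
@[simp] theorem cost_ask (t : CoordTest n) : (ask t).cost ans = 1 := rfl
@[simp] theorem write_ask (t : CoordTest n) (o : Output n) : (ask t).write ans o = o := rfl
@[simp] theorem cost_tick : (tick : CProg n Unit).cost ans = 1 := rfl
@[simp] theorem write_tick (o : Output n) : (tick : CProg n Unit).write ans o = o := rfl
@[simp] theorem cost_addFront (i : Fin n) : (addFront i).cost ans = 1 := rfl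
@[simp] theorem write_addFront (i : Fin n) (o : Output n) :
    (addFront i).write ans o = { o with front := o.front ++ [i] } := rfl
@[simp] theorem cost_addWitness (i j : Fin n) : (addWitness i j).cost ans = 1 := rfl
@[simp] theorem write_addWitness (i j : Fin n) (o : Output n) :
    (addWitness i j).write ans o =
      { o with witness := Function.update o.witness i (some j) } := rfl

@[simp] theorem value_count (l : List (Fin n)) (a : ℕ) :
    (count l a).value ans = a + l.length := by
  induction l generalizing a with
  | nil => simp [count]
  | cons i l ih => simp [count, ih]; omega

@[simp] theorem cost_count (l : List (Fin n)) (a : ℕ) :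
    (count l a).cost ans = l.length + 1 := by
  induction l generalizing a with
  | nil => simp [count]
  | cons i l ih => simp [count, ih]; omega

@[simp] theorem write_count (l : List (Fin n)) (a : ℕ) (o : Output n) :
    (count l a).write ans o = o := by
  induction l generalizing a with
  | nil => simp [count]
  | cons i l ih => simp [count, ih]

@[simp] theorem value_rev (l acc : List (Fin n)) :
    (rev l acc).value ans = l.reverse ++ acc := by
  induction l generalizing acc with
  | nil => simp [rev]
  | cons i l ih => simp [rev, ih]

@[simp] theorem cost_rev (l acc : List (Fin n)) : (rev l acc).cost ans = l.length + 1 := by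
  induction l generalizing acc with
  | nil => simp [rev]
  | cons i l ih => simp [rev, ih]; omega

@[simp] theorem write_rev (l acc : List (Fin n)) (o : Output n) :
    (rev l acc).write ans o = o := by
  induction l generalizing acc with
  | nil => simp [rev]
  | cons i l ih => simp [rev, ih]

@[simp] theorem value_nth (l : List (Fin n)) (k : ℕ) : (nth l k).value ans = l[k]? := by
  induction l generalizing k with
  | nil => simp [nth]
  | cons i l ih => cases k <;> simp [nth, ih]

theorem cost_nth_le (l : List (Fin n)) (k : ℕ) : (nth l k).cost ans ≤ l.length + 1 := by
  induction l generalizing k with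
  | nil => simp [nth]
  | cons i l ih =>
    cases k with
    | zero => simp [nth]
    | succ k => have := ih k; simp [nth]; omega

@[simp] theorem write_nth (l : List (Fin n)) (k : ℕ) (o : Output n) :
    (nth l k).write ans o = o := by
  induction l generalizing k with
  | nil => simp [nth]
  | cons i l ih => cases k <;> simp [nth, ih]

@[simp] theorem value_select (t : Fin n → CoordTest n) (l : List (Fin n)) :
    (select t l).value ans = l.filter fun i => ans (t i) := by
  induction l with
  | nil => simp [select]
  | cons i l ih => simp [select, ih, List.filter_cons]

@[simp] theorem cost_select (t : Fin n → CoordTest n) (l : List (Fin n)) :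
    (select t l).cost ans = 2 * l.length + 1 := by
  induction l with
  | nil => simp [select]
  | cons i l ih => simp [select, ih]; omega

@[simp] theorem write_select (t : Fin n → CoordTest n) (l : List (Fin n)) (o : Output n) :
    (select t l).write ans o = o := by
  induction l with
  | nil => simp [select]
  | cons i l ih => simp [select, ih]

theorem value_isSorted (lt : Fin n → Fin n → CoordTest n) (l : List (Fin n)) :
    (isSorted lt l).value ans = true ↔ l.IsChain fun i j => ans (lt i j) = true := by
  induction l with
  | nil => simp [isSorted]
  | cons i l ih =>
    cases l with
    | nil => simp [isSorted]
    | cons j l =>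
      by_cases h : ans (lt i j) = true <;> simp [isSorted, h, ih]

theorem cost_isSorted_le (lt : Fin n → Fin n → CoordTest n) (l : List (Fin n)) :
    (isSorted lt l).cost ans ≤ 2 * l.length + 1 := by
  induction l with
  | nil => simp [isSorted]
  | cons i l ih =>
    cases l with
    | nil => simp [isSorted]
    | cons j l =>
      by_cases h : ans (lt i j) = true <;> simp [isSorted, h] at ih ⊢ <;> omega

@[simp] theorem write_isSorted (lt : Fin n → Fin n → CoordTest n) (l : List (Fin n))
    (o : Output n) : (isSorted lt l).write ans o = o := by
  induction l with
  | nil => simp [isSorted]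
  | cons i l ih =>
    cases l with
    | nil => simp [isSorted]
    | cons j l =>
      by_cases h : ans (lt i j) = true <;> simp [isSorted, h, ih]

theorem perm_value_insertX (i : Fin n) (l : List (Fin n)) :
    ((insertX i l).value ans).Perm (i :: l) := by
  induction l with
  | nil => simp [insertX]
  | cons j l ih =>
    by_cases h : ans (.x i j) = true
    · simp [insertX, h]
    · simpa [insertX, h] using (ih.cons j).trans (List.Perm.swap i j l)

theorem cost_insertX_le (i : Fin n) (l : List (Fin n)) :
    (insertX i l).cost ans ≤ 2 * l.length + 1 := by
  induction l with
  | nil => simp [insertX]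
  | cons j l ih =>
    by_cases h : ans (.x i j) = true <;> simp [insertX, h] <;> omega

@[simp] theorem write_insertX (i : Fin n) (l : List (Fin n)) (o : Output n) :
    (insertX i l).write ans o = o := by
  induction l with
  | nil => simp [insertX]
  | cons j l ih =>
    by_cases h : ans (.x i j) = true <;> simp [insertX, h, ih]

theorem perm_value_sortX (l : List (Fin n)) : ((sortX l).value ans).Perm l := by
  induction l with
  | nil => simp [sortX]
  | cons i l ih =>
    simp only [sortX, Prog.value_bind]
    exact (perm_value_insertX ans i _).trans (ih.cons i)

theorem cost_sortX_le (l : List (Fin n)) :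
    (sortX l).cost ans ≤ (2 * l.length + 2) * (l.length + 1) := by
  induction l with
  | nil => simp [sortX]
  | cons i l ih =>
    have h := cost_insertX_le ans i ((sortX l).value ans)
    have h' := (perm_value_sortX ans l).length_eq
    simp [sortX]
    nlinarith

@[simp] theorem write_sortX (l : List (Fin n)) (o : Output n) :
    (sortX l).write ans o = o := by
  induction l with
  | nil => simp [sortX]
  | cons i l ih => simp [sortX, ih]

@[simp] theorem value_readInput (k : ℕ) (h : k ≤ n) (acc : List (Fin n)) :
    (readInput k h acc).value ans = (List.finRange k).map (Fin.castLE h) ++ acc := by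
  induction k generalizing acc with
  | zero => simp [readInput]
  | succ k ih =>
    simp [readInput, ih, List.finRange_succ_last]
    rfl

@[simp] theorem cost_readInput (k : ℕ) (h : k ≤ n) (acc : List (Fin n)) :
    (readInput k h acc).cost ans = k + 1 := by
  induction k generalizing acc with
  | zero => simp [readInput]
  | succ k ih => simp [readInput, ih]; omega

@[simp] theorem write_readInput (k : ℕ) (h : k ≤ n) (acc : List (Fin n)) (o : Output n) :
    (readInput k h acc).write ans o = o := by
  induction k generalizing acc with
  | zero => simp [readInput]
  | succ k ih => simp [readInput, ih]

end Programs

/-! ### Linear-time selection -/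

section Selection

variable {n : ℕ} (I : Input n)

theorem pairwise_value_insertX (i : Fin n) (l : List (Fin n))
    (hl : l.Pairwise fun a b => (I a).1 ≤ (I b).1) :
    ((insertX i l).value (CoordTest.eval I)).Pairwise fun a b => (I a).1 ≤ (I b).1 := by
  induction l with
  | nil => simp [insertX]
  | cons j l ih =>
    rw [List.pairwise_cons] at hl
    by_cases h : (I i).1 < (I j).1
    · simp only [insertX, Prog.value_bind, value_ask, CoordTest.eval, h, decide_true, if_true,
        Prog.value_pure, List.pairwise_cons, List.mem_cons]
      refine ⟨?_, hl⟩
      rintro a (rfl | ha)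
      · exact h.le
      · exact h.le.trans (hl.1 a ha)
    · simp only [insertX, Prog.value_bind, value_ask, CoordTest.eval, h, decide_false,
        Bool.false_eq_true, if_false, Prog.value_pure, List.pairwise_cons]
      refine ⟨fun a ha => ?_, ih hl.2⟩
      rcases List.mem_cons.1 ((perm_value_insertX _ i l).mem_iff.1 ha) with rfl | ha
      · exact not_lt.1 h
      · exact hl.1 a ha

theorem pairwise_value_sortX (l : List (Fin n)) :
    ((sortX l).value (CoordTest.eval I)).Pairwise fun a b => (I a).1 ≤ (I b).1 := by
  induction l with
  | nil => simp [sortX]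
  | cons i l ih => simpa [sortX] using pairwise_value_insertX I i _ ih

theorem countP_lt_getElem {α : Type*} (x : α → ℝ) (s : List α)
    (hs : s.Pairwise fun a b => x a < x b) (k : ℕ) (m : α) (hm : s[k]? = some m) :
    s.countP (fun i => decide (x i < x m)) = k := by
  induction s generalizing k with
  | nil => simp at hm
  | cons a s ih =>
    rw [List.pairwise_cons] at hs
    cases k with
    | zero =>
      obtain rfl : a = m := by simpa using hm
      rw [List.countP_eq_zero]
      intro b hb
      rcases List.mem_cons.1 hb with rfl | hb
      · simp
      · simpa using (hs.1 b hb).le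
    | succ k =>
      have hm' : s[k]? = some m := by simpa using hm
      have := hs.1 m (List.mem_of_getElem? hm')
      simp [ih hs.2 k hm', this]

/-- The third of five sorted entries has two on either side, so a set closed downwards or upwards in
x that contains it contains three of the five. The arbitrary `U` lets the same count serve both
sides of the pivot. -/
theorem value_groupMedians_cons (a b c d e : Fin n) (l : List (Fin n)) :
    ∃ m ∈ [a, b, c, d, e],
      (groupMedians (a :: b :: c :: d :: e :: l)).value (CoordTest.eval I) =
        m :: (groupMedians l).value (CoordTest.eval I) ∧
      (∀ U : Fin n → Bool, (∀ i j, (I j).1 ≤ (I i).1 → U i = true → U j = true) → U m = true →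
        3 ≤ [a, b, c, d, e].countP U) ∧
      ∀ U : Fin n → Bool, (∀ i j, (I i).1 ≤ (I j).1 → U i = true → U j = true) → U m = true →
        3 ≤ [a, b, c, d, e].countP U := by
  have hp := perm_value_sortX (CoordTest.eval I) [a, b, c, d, e]
  have hs := pairwise_value_sortX I [a, b, c, d, e]
  have hlen := hp.length_eq
  set s := (sortX [a, b, c, d, e]).value (CoordTest.eval I) with hsdef
  obtain ⟨s₀, s₁, s₂, s₃, s₄, h⟩ : ∃ s₀ s₁ s₂ s₃ s₄, s = [s₀, s₁, s₂, s₃, s₄] := by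
    match s, hlen with
    | [s₀, s₁, s₂, s₃, s₄], _ => exact ⟨_, _, _, _, _, rfl⟩
  rw [h] at hp hs
  simp only [List.pairwise_cons, List.mem_cons] at hs
  refine ⟨s₂, hp.mem_iff.1 (by simp), ?_, fun U hU hm => ?_, fun U hU hm => ?_⟩
  · simp [groupMedians, ← hsdef, h]
  · rw [← hp.countP_eq]
    have h₀ : U s₀ = true := hU s₂ s₀ (hs.1 _ (by simp)) hm
    have h₁ : U s₁ = true := hU s₂ s₁ (hs.2.1 _ (by simp)) hm
    simp [List.countP_cons, h₀, h₁, hm]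
  · rw [← hp.countP_eq]
    have h₃ : U s₃ = true := hU s₂ s₃ (hs.2.2.1 _ (by simp)) hm
    have h₄ : U s₄ = true := hU s₂ s₄ (hs.2.2.1 _ (by simp)) hm
    simp only [List.countP_cons, h₃, h₄, hm, if_true]
    omega

theorem subperm_value_groupMedians (l : List (Fin n)) :
    ((groupMedians l).value (CoordTest.eval I)).Subperm l := by
  induction l using groupMedians.induct with
  | case1 a b c d e l ih =>
    obtain ⟨m, hm, h, -⟩ := value_groupMedians_cons I a b c d e l
    rw [h]
    have h₁ : [m].Subperm [a, b, c, d, e] := List.singleton_subperm_iff.2 hm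
    exact h₁.append ih
  | case2 l hl =>
    rw [groupMedians.eq_2 l hl]
    simp

theorem length_value_groupMedians (l : List (Fin n)) :
    ((groupMedians l).value (CoordTest.eval I)).length = l.length / 5 := by
  induction l using groupMedians.induct with
  | case1 a b c d e l ih =>
    obtain ⟨m, -, h, -⟩ := value_groupMedians_cons I a b c d e l
    rw [h]
    simp [ih]
    omega
  | case2 l hl =>
    rw [groupMedians.eq_2 l hl]
    match l, hl with
    | [], _ => simp
    | [_], _ => simp
    | [_, _], _ => simp
    | [_, _, _], _ => simp
    | [_, _, _, _], _ => simp
    | a :: b :: c :: d :: e :: l, hl => exact absurd rfl (hl a b c d e l)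

theorem countP_groupMedians_le (U : Fin n → Bool)
    (hU : (∀ i j, (I j).1 ≤ (I i).1 → U i = true → U j = true) ∨
      ∀ i j, (I i).1 ≤ (I j).1 → U i = true → U j = true) (l : List (Fin n)) :
    3 * ((groupMedians l).value (CoordTest.eval I)).countP U ≤ l.countP U := by
  induction l using groupMedians.induct with
  | case1 a b c d e l ih =>
    obtain ⟨m, -, h, h₁, h₂⟩ := value_groupMedians_cons I a b c d e l
    have h₃ : U m = true → 3 ≤ [a, b, c, d, e].countP U :=
      hU.elim (h₁ U) (h₂ U)
    have h₄ : (a :: b :: c :: d :: e :: l).countP U =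
        [a, b, c, d, e].countP U + l.countP U := by
      rw [← List.countP_append]; rfl
    rw [h, h₄, List.countP_cons]
    split_ifs with hm
    · have := h₃ hm
      omega
    · omega
  | case2 l hl =>
    rw [groupMedians.eq_2 l hl]
    simp

theorem cost_groupMedians_le (l : List (Fin n)) :
    (groupMedians l).cost (CoordTest.eval I) ≤ 20 * l.length + 1 := by
  induction l using groupMedians.induct with
  | case1 a b c d e l ih =>
    have h₁ := cost_sortX_le (CoordTest.eval I) [a, b, c, d, e]
    have h₂ := cost_nth_le (CoordTest.eval I)
      ((sortX [a, b, c, d, e]).value (CoordTest.eval I)) 2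
    rw [(perm_value_sortX (CoordTest.eval I) [a, b, c, d, e]).length_eq] at h₂
    simp only [List.length_cons, List.length_nil] at h₁ h₂
    simp only [groupMedians, Prog.cost_bind, cost_tick, List.length_cons]
    split <;> simp only [Prog.cost_pure] <;> omega
  | case2 l hl =>
    rw [groupMedians.eq_2 l hl]
    simp

@[simp] theorem write_groupMedians (l : List (Fin n)) (o : Output n) :
    (groupMedians l).write (CoordTest.eval I) o = o := by
  induction l using groupMedians.induct with
  | case1 a b c d e l ih =>
    simp only [groupMedians, Prog.write_bind, write_tick, write_sortX, write_nth, ih]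
    split <;> simp
  | case2 l hl =>
    rw [groupMedians.eq_2 l hl]
    simp

@[simp] theorem write_selectRank (fuel : ℕ) (l : List (Fin n)) (k : ℕ) (o : Output n) :
    (selectRank fuel l k).write (CoordTest.eval I) o = o := by
  induction fuel generalizing l k with
  | zero => simp [selectRank]
  | succ fuel ih =>
    simp only [selectRank, Prog.write_bind, write_tick, write_count]
    split_ifs
    · simp
    · simp only [Prog.write_bind, write_groupMedians, write_count, ih]
      split
      · simp
      · simp only [Prog.write_bind, write_select, write_count]
        split_ifs <;> simp [ih]

theorem nodup_of_subperm {α : Type*} {l l' : List α} (h : l.Subperm l') (hl' : l'.Nodup) :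
    l.Nodup := by
  obtain ⟨l'', hp, hs⟩ := h
  exact hp.nodup_iff.1 (hl'.sublist hs)

theorem countP_add_countP_not {α : Type*} (p : α → Bool) (l : List α) :
    l.countP p + l.countP (fun a => !p a) = l.length := by
  rw [List.length_eq_countP_add_countP p]
  simp

/-- About half of the n/5 group medians lie on each side of the pivot, and each brings three entries
of its group. So `lo` and `hi` each miss about 3n/10 entries, and n/5 + 7n/10 < n gives a linear
recurrence; the cutoff at 50 leaves room for the rounding. -/
theorem selectRank_spec (hI : Function.Injective fun i => (I i).1) (fuel : ℕ)
    (l : List (Fin n)) (k : ℕ) (hl : l.Nodup) (hfuel : l.length ≤ fuel) (hk : k < l.length) :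
    (∃ m ∈ l, (selectRank fuel l k).value (CoordTest.eval I) = some m ∧
      l.countP (fun i => decide ((I i).1 < (I m).1)) = k) ∧
    (selectRank fuel l k).cost (CoordTest.eval I) ≤ 2000 * (l.length + 1) := by
  induction fuel generalizing l k with
  | zero => omega
  | succ fuel ih =>
    by_cases h50 : l.length ≤ 50
    · have hp := perm_value_sortX (CoordTest.eval I) l
      have hs := pairwise_value_sortX I l
      have hc := cost_sortX_le (CoordTest.eval I) l
      have hc' := cost_nth_le (CoordTest.eval I) ((sortX l).value (CoordTest.eval I)) k
      simp only [selectRank, Prog.value_bind, value_count, Prog.cost_bind, cost_tick, cost_count,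
        zero_add, h50, if_true]
      rw [hp.length_eq] at hc'
      refine ⟨?_, by nlinarith⟩
      rw [← hp.length_eq] at hk
      refine ⟨_, hp.mem_iff.1 (List.getElem_mem hk), by simp [hk], ?_⟩
      rw [← hp.countP_eq]
      refine countP_lt_getElem (fun i => (I i).1) _ ?_ k _ (by simp [hk])
      refine (hs.and (hp.nodup_iff.2 hl)).imp fun {a b} h => lt_of_le_of_ne h.1 fun he => h.2 (hI he)
    · have hg := length_value_groupMedians I l
      have hsub := subperm_value_groupMedians I l
      have hgc := cost_groupMedians_le I l
      have hcount := fun U hU => countP_groupMedians_le I U hU l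
      set ms := (groupMedians l).value (CoordTest.eval I) with hms
      obtain ⟨⟨p, hpm, hpv, hpr⟩, hpc⟩ := ih ms (ms.length / 2) (nodup_of_subperm hsub hl)
        (by omega) (by omega)
      have hpl : p ∈ l := hsub.subset hpm
      have hlo := hcount (fun i => decide ((I p).1 ≤ (I i).1))
        (Or.inr fun i j hij hi => by simp at hi ⊢; linarith)
      have hhi := hcount (fun i => decide ((I i).1 ≤ (I p).1))
        (Or.inl fun i j hij hi => by simp at hi ⊢; linarith)
      have e₁ := countP_add_countP_not (fun i => decide ((I i).1 < (I p).1)) ms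
      have e₂ := countP_add_countP_not (fun i => decide ((I i).1 < (I p).1)) l
      have e₃ := countP_add_countP_not (fun i => decide ((I i).1 ≤ (I p).1)) l
      have e₄ : ms.countP (fun i => decide ((I i).1 < (I p).1)) ≤
          ms.countP (fun i => decide ((I i).1 ≤ (I p).1)) :=
        List.countP_mono_left fun i _ hi => by simp at hi ⊢; exact hi.le
      simp only [← decide_not, not_lt, not_le] at e₁ e₂ e₃
      set lo := l.filter fun i => decide ((I i).1 < (I p).1) with hlodef
      set hi := l.filter fun i => decide ((I p).1 < (I i).1) with hhidef
      have l₁ : lo.length = l.countP fun i => decide ((I i).1 < (I p).1) :=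
        List.countP_eq_length_filter.symm
      have l₂ : hi.length = l.countP fun i => decide ((I p).1 < (I i).1) :=
        List.countP_eq_length_filter.symm
      have hle : l.countP (fun i => decide ((I i).1 ≤ (I p).1)) = lo.length + 1 := by
        rw [List.countP_eq_countP_filter_add l _ fun i => decide ((I i).1 < (I p).1), ← hlodef]
        congr 1
        · rw [List.countP_eq_length]
          intro i hi
          simpa using (of_decide_eq_true (List.mem_filter.1 hi).2).le
        · rw [← List.count_eq_one_of_mem hl hpl, List.count, List.countP_filter]
          refine List.countP_congr fun i _ => ?_
          simp only [← decide_not, not_lt, Bool.and_eq_true, decide_eq_true_eq, beq_iff_eq]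
          exact ⟨fun h => hI (le_antisymm h.1 h.2), fun h => by simp [h]⟩
      simp only [selectRank, Prog.value_bind, value_count, Prog.cost_bind, cost_tick, cost_count,
        zero_add, h50, if_false, ← hms, hpv, value_select, cost_select, CoordTest.eval,
        ← hlodef, ← hhidef]
      by_cases c₁ : k < lo.length
      · obtain ⟨⟨m, hm, hv, hr⟩, hc⟩ := ih lo k (hl.filter _) (by omega) c₁
        rw [if_pos c₁]
        refine ⟨⟨m, List.mem_of_mem_filter hm, hv, ?_⟩, ?_⟩
        · rw [← hr, hlodef, List.countP_filter]
          refine List.countP_congr fun i _ => ?_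
          have : (I m).1 < (I p).1 := by simpa using (List.mem_filter.1 hm).2
          simp
          intro h
          linarith
        · omega
      · rw [if_neg c₁]
        by_cases c₂ : k = lo.length
        · rw [if_pos c₂]
          refine ⟨⟨p, hpl, rfl, by rw [← l₁, c₂]⟩, ?_⟩
          simp only [Prog.cost_pure]
          omega
        · obtain ⟨⟨m, hm, hv, hr⟩, hc⟩ := ih hi (k - lo.length - 1) (hl.filter _)
            (by omega) (by omega)
          have hpmlt : (I p).1 < (I m).1 := by simpa using (List.mem_filter.1 hm).2
          rw [if_neg c₂]
          refine ⟨⟨m, List.mem_of_mem_filter hm, hv, ?_⟩, ?_⟩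
          · rw [List.countP_eq_countP_filter_add l _ fun i => decide ((I p).1 < (I i).1), ← hhidef,
              hr]
            have : (l.filter fun i => !decide ((I p).1 < (I i).1)).countP
                (fun i => decide ((I i).1 < (I m).1)) = lo.length + 1 := by
              rw [← hle, List.countP_filter]
              refine List.countP_congr fun i _ => ?_
              simp only [← decide_not, not_lt, Bool.and_eq_true, decide_eq_true_eq]
              exact ⟨fun h => h.2, fun h => ⟨h.trans_lt hpmlt, h⟩⟩
            omega
          · omega

end Selection

/-! ### Correctness of the algorithm -/

section Correctness

variable {n : ℕ} (I : Input n)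

/-- `F` lists the indices in `l` of the points that no point of `l` dominates. -/
def IsFrontOf (l F : List (Fin n)) : Prop :=
  ∀ i, i ∈ F ↔ i ∈ l ∧ ∀ j ∈ l, ¬ Dominates (I j) (I i)

/-- From `w` to `w'`, exactly the entries of `l` outside `F` received a witness, taken from `l`. -/
def AddsWitnesses (l F : List (Fin n)) (w w' : Fin n → Option (Fin n)) : Prop :=
  (∀ i, i ∈ F ∨ i ∉ l → w' i = w i) ∧
  ∀ i ∈ l, i ∉ F → ∃ j ∈ l, w' i = some j ∧ Dominates (I j) (I i)

/-- The program appends the Pareto front of the points of `l` and writes witnesses for the other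
points of `l`. -/
def Solves {α : Type} (l : List (Fin n)) (A : CProg n α) : Prop :=
  ∀ o, ∃ F, (A.write (CoordTest.eval I) o).front = o.front ++ F ∧
    F.Pairwise (fun i j => (I i).1 < (I j).1) ∧ IsFrontOf I l F ∧
    AddsWitnesses I l F o.witness (A.write (CoordTest.eval I) o).witness

variable {I}

theorem dominates_iff (hx : Function.Injective fun i => (I i).1)
    (hy : Function.Injective fun i => (I i).2) (i j : Fin n) :
    Dominates (I j) (I i) ↔ (I i).1 < (I j).1 ∧ (I i).2 < (I j).2 := by
  constructor
  · rintro ⟨hne, h₁, h₂⟩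
    have hij : i ≠ j := fun h => hne (by rw [h])
    exact ⟨lt_of_le_of_ne h₁ fun h => hij (hx h), lt_of_le_of_ne h₂ fun h => hij (hy h)⟩
  · rintro ⟨h₁, h₂⟩
    exact ⟨fun h => by simp [h] at h₁, h₁.le, h₂.le⟩

theorem IsFrontOf.congr {l l' F F' : List (Fin n)} (h : IsFrontOf I l F)
    (hl : ∀ i, i ∈ l ↔ i ∈ l') (hF : ∀ i, i ∈ F ↔ i ∈ F') : IsFrontOf I l' F' := by
  intro i
  simp only [← hl, ← hF]
  exact h i

theorem AddsWitnesses.congr {l l' F F' : List (Fin n)} {w w' : Fin n → Option (Fin n)}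
    (h : AddsWitnesses I l F w w') (hl : ∀ i, i ∈ l ↔ i ∈ l') (hF : ∀ i, i ∈ F ↔ i ∈ F') :
    AddsWitnesses I l' F' w w' := by
  unfold AddsWitnesses
  simp only [← hl, ← hF]
  exact h

/-- Here `u` is the sorted coordinate and `v` the compared one; dominance is symmetric in them, so
one lemma serves both sorting directions. The claim concerns only `b :: l`, so `acc` is inert. No
point of `l` dominates `b`, which has the largest `u`. If the next point has larger `v`, then `b` is
final and all later front points exceed it in `v`; otherwise `b` dominates the next point and
everything that point dominates. -/
theorem sweep_spec {lt : Fin n → Fin n → CoordTest n} {u v : Fin n → ℝ}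
    (hlt : ∀ i j, (lt i j).eval I = decide (v i < v j)) (hv : Function.Injective v)
    (hdom : ∀ i j, Dominates (I j) (I i) ↔ u i < u j ∧ v i < v j)
    (l : List (Fin n)) (b : Fin n) (acc : List (Fin n))
    (hl : (b :: l).Pairwise fun i j => u j < u i) :
    ∃ G, (sweep lt b acc l).value (CoordTest.eval I) = G ++ acc ∧
      G.Pairwise (fun i j => u i < u j ∧ v j < v i) ∧ IsFrontOf I (b :: l) G ∧
      ∀ o, ((sweep lt b acc l).write (CoordTest.eval I) o).front = o.front ∧
        AddsWitnesses I (b :: l) G o.witness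
          ((sweep lt b acc l).write (CoordTest.eval I) o).witness := by
  induction l generalizing b acc with
  | nil =>
    refine ⟨[b], by simp [sweep], by simp, ?_, fun o => ⟨by simp [sweep], ?_, ?_⟩⟩
    · intro i
      simp only [List.mem_singleton, hdom]
      constructor
      · rintro rfl
        exact ⟨rfl, by simp⟩
      · exact fun h => h.1
    · simp [sweep]
    · simp
  | cons i l ih =>
    have hbi : u i < u b := (List.pairwise_cons.1 hl).1 i (by simp)
    have hil := (List.pairwise_cons.1 hl).2
    have hne : i ≠ b := fun h => by simp [h] at hbi
    by_cases h : v b < v i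
    · obtain ⟨G, hval, hpw, hfr, hw⟩ := ih i (b :: acc) hil
      have hbG : ∀ k ∈ G, u k < u b ∧ v b < v k := by
        intro k hk
        obtain ⟨hk, hk'⟩ := (hfr k).1 hk
        refine ⟨(List.pairwise_cons.1 hl).1 k hk, ?_⟩
        rcases List.mem_cons.1 hk with rfl | hkl
        · exact h
        · have h₁ := hk' i (by simp)
          rw [hdom] at h₁
          have h₂ := (List.pairwise_cons.1 hil).1 k hkl
          by_contra h₃
          exact h₁ ⟨h₂, (not_lt.1 h₃).trans_lt h⟩
      refine ⟨G ++ [b], ?_, ?_, ?_, fun o => ?_⟩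
      · simp [sweep, hlt, h, hval]
      · rw [List.pairwise_append]
        exact ⟨hpw, by simp, fun k hk j hj => by rw [List.mem_singleton.1 hj]; exact hbG k hk⟩
      · intro k
        rw [List.mem_append, List.mem_singleton]
        constructor
        · rintro (hk | rfl)
          · refine ⟨List.mem_cons_of_mem _ ((hfr k).1 hk).1, fun j hj => ?_⟩
            rcases List.mem_cons.1 hj with rfl | hj
            · rw [hdom]
              exact fun h' => lt_asymm h'.2 (hbG k hk).2
            · exact ((hfr k).1 hk).2 j hj
          · refine ⟨by simp, fun j hj => ?_⟩
            rw [hdom]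
            rcases List.mem_cons.1 hj with rfl | hj
            · simp
            · exact fun h' => lt_asymm h'.1 ((List.pairwise_cons.1 hl).1 j hj)
        · rintro ⟨hk, hk'⟩
          rcases List.mem_cons.1 hk with rfl | hk
          · exact Or.inr rfl
          · exact Or.inl ((hfr k).2 ⟨hk, fun j hj => hk' j (List.mem_cons_of_mem _ hj)⟩)
      · have hwr : (sweep lt b acc (i :: l)).write (CoordTest.eval I) o =
            (sweep lt i (b :: acc) l).write (CoordTest.eval I) o := by
          simp [sweep, hlt, h]
        rw [hwr]
        obtain ⟨h₁, h₂, h₃⟩ := hw o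
        have hb : b ∉ i :: l := fun hb => lt_irrefl _ ((List.pairwise_cons.1 hl).1 b hb)
        refine ⟨h₁, fun k hk => h₂ k ?_, fun k hk hkG => ?_⟩
        · rw [List.mem_append, List.mem_singleton] at hk
          rcases hk with (hk | rfl) | hk
          · exact Or.inl hk
          · exact Or.inr hb
          · exact Or.inr fun h' => hk (List.mem_cons_of_mem _ h')
        · rw [List.mem_append, List.mem_singleton, not_or] at hkG
          obtain ⟨j, hj, hj'⟩ := h₃ k ((List.mem_cons.1 hk).resolve_left hkG.2) hkG.1
          exact ⟨j, List.mem_cons_of_mem _ hj, hj'⟩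
    · have hbl : (b :: l).Pairwise fun i j => u j < u i :=
        hl.sublist ((List.sublist_cons_self i l).cons_cons b)
      obtain ⟨G, hval, hpw, hfr, hw⟩ := ih b acc hbl
      have hvi : v i < v b := lt_of_le_of_ne (not_lt.1 h) fun h' => hne (hv h')
      have hib : Dominates (I b) (I i) := (hdom i b).2 ⟨hbi, hvi⟩
      have hiG : i ∉ G := fun hi => ((hfr i).1 hi).2 b (by simp) hib
      have hil' : i ∉ b :: l := by
        rw [List.mem_cons, not_or]
        exact ⟨hne, fun hi => lt_irrefl _ ((List.pairwise_cons.1 hil).1 i hi)⟩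
      refine ⟨G, by simp [sweep, hlt, h, hval], hpw, ?_, fun o => ?_⟩
      · intro k
        rw [hfr k]
        constructor
        · rintro ⟨hk, hk'⟩
          refine ⟨?_, fun j hj hjk => ?_⟩
          · rcases List.mem_cons.1 hk with rfl | hk <;> simp [*]
          · by_cases hji : j = i
            · refine hk' b (by simp) ?_
              rw [hdom] at hjk ⊢
              rw [hji] at hjk
              exact ⟨hjk.1.trans hbi, hjk.2.trans hvi⟩
            · refine hk' j ?_ hjk
              simp only [List.mem_cons, hji, false_or] at hj ⊢
              exact hj
        · rintro ⟨hk, hk'⟩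
          refine ⟨?_, fun j hj => hk' j ?_⟩
          · have hki : k ≠ i := fun h' => hk' b (by simp) (h' ▸ hib)
            simp only [List.mem_cons, hki, false_or] at hk ⊢
            exact hk
          · rcases List.mem_cons.1 hj with rfl | hj <;> simp [*]
      · have hwr : (sweep lt b acc (i :: l)).write (CoordTest.eval I) o =
            (sweep lt b acc l).write (CoordTest.eval I)
              { o with witness := Function.update o.witness i (some b) } := by
          simp [sweep, hlt, h]
        rw [hwr]
        -- The witness of `i` is written before the rest of the sweep, which leaves it alone because
        -- `i` is not in `b :: l`.
        obtain ⟨h₁, h₂, h₃⟩ := hw { o with witness := Function.update o.witness i (some b) }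
        refine ⟨h₁, fun k hk => ?_, fun k hk hkG => ?_⟩
        · have hki : k ≠ i := by
            rintro rfl
            exact hk.elim hiG fun h' => h' (by simp)
          have hk' : k ∈ G ∨ k ∉ b :: l := hk.imp_right fun h' h'' => h' <| by
            simp only [List.mem_cons] at h'' ⊢
            tauto
          rw [h₂ k hk']
          exact Function.update_of_ne hki _ _
        · by_cases hki : k = i
          · subst hki
            refine ⟨b, by simp, ?_, hib⟩
            rw [h₂ k (Or.inr hil')]
            simp
          · have hk' : k ∈ b :: l := by
              simp only [List.mem_cons, hki, false_or] at hk ⊢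
              exact hk
            obtain ⟨j, hj, hj'⟩ := h₃ k hk' hkG
            refine ⟨j, ?_, hj'⟩
            rcases List.mem_cons.1 hj with rfl | hj <;> simp [*]

theorem cost_sweep_le (ans : CoordTest n → Bool) (lt : Fin n → Fin n → CoordTest n)
    (l : List (Fin n)) (b : Fin n) (acc : List (Fin n)) :
    (sweep lt b acc l).cost ans ≤ 3 * l.length + 1 := by
  induction l generalizing b acc with
  | nil => simp [sweep]
  | cons i l ih =>
    by_cases h : ans (lt b i) = true
    · have := ih i (b :: acc)
      simp [sweep, h]
      omega
    · have := ih b acc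
      simp [sweep, h]
      omega

theorem sweepAll_spec {lt : Fin n → Fin n → CoordTest n} {u v : Fin n → ℝ}
    (hlt : ∀ i j, (lt i j).eval I = decide (v i < v j)) (hv : Function.Injective v)
    (hdom : ∀ i j, Dominates (I j) (I i) ↔ u i < u j ∧ v i < v j)
    (l : List (Fin n)) (hl : l.Pairwise fun i j => u j < u i) :
    ((sweepAll lt l).value (CoordTest.eval I)).Pairwise (fun i j => u i < u j ∧ v j < v i) ∧
      IsFrontOf I l ((sweepAll lt l).value (CoordTest.eval I)) ∧
      ∀ o, ((sweepAll lt l).write (CoordTest.eval I) o).front = o.front ∧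
        AddsWitnesses I l ((sweepAll lt l).value (CoordTest.eval I)) o.witness
          ((sweepAll lt l).write (CoordTest.eval I) o).witness := by
  cases l with
  | nil => simp [sweepAll, IsFrontOf, AddsWitnesses]
  | cons b l =>
    obtain ⟨G, hval, h⟩ := sweep_spec hlt hv hdom l b [] hl
    rw [List.append_nil] at hval
    simpa [sweepAll, hval] using h

theorem cost_sweepAll_le (ans : CoordTest n → Bool) (lt : Fin n → Fin n → CoordTest n)
    (l : List (Fin n)) : (sweepAll lt l).cost ans ≤ 3 * l.length + 1 := by
  cases l with
  | nil => simp [sweepAll]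
  | cons b l =>
    have := cost_sweep_le ans lt l b []
    simp [sweepAll]
    omega

@[simp] theorem write_emit (ans : CoordTest n → Bool) (l : List (Fin n)) (o : Output n) :
    (emit l).write ans o = { o with front := o.front ++ l } := by
  induction l generalizing o with
  | nil => simp [emit]
  | cons i l ih => simp [emit, ih]

@[simp] theorem cost_emit (ans : CoordTest n → Bool) (l : List (Fin n)) :
    (emit l).cost ans = 2 * l.length + 1 := by
  induction l with
  | nil => simp [emit]
  | cons i l ih => simp [emit, ih]; omega

theorem length_value_sweep_le (ans : CoordTest n → Bool) (lt : Fin n → Fin n → CoordTest n)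
    (l : List (Fin n)) (b : Fin n) (acc : List (Fin n)) :
    ((sweep lt b acc l).value ans).length ≤ l.length + acc.length + 1 := by
  induction l generalizing b acc with
  | nil => simp [sweep]
  | cons i l ih =>
    by_cases h : ans (lt b i) = true
    · have := ih i (b :: acc)
      simp [sweep, h] at this ⊢
      omega
    · have := ih b acc
      simp [sweep, h]
      omega

theorem length_value_sweepAll_le (ans : CoordTest n → Bool) (lt : Fin n → Fin n → CoordTest n)
    (l : List (Fin n)) : ((sweepAll lt l).value ans).length ≤ l.length := by
  cases l with
  | nil => simp [sweepAll]
  | cons b l => simpa [sweepAll] using length_value_sweep_le ans lt l b []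

theorem cost_trySorted_le (ans : CoordTest n → Bool) (l : List (Fin n)) :
    (trySorted l).cost ans ≤ 20 * (l.length + 1) := by
  have h₁ := fun lt => cost_isSorted_le ans lt l
  have h₂ := fun lt => cost_sweepAll_le ans lt l
  have h₃ := fun lt => cost_sweepAll_le ans lt l.reverse
  have h₄ := fun lt => length_value_sweepAll_le ans lt l
  have h₅ := fun lt => length_value_sweepAll_le ans lt l.reverse
  simp only [List.length_reverse] at h₃ h₅
  have a₁ := h₁ fun i j => .x i j
  have a₂ := h₁ fun i j => .x j i
  have a₃ := h₁ fun i j => .y i j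
  have a₄ := h₁ fun i j => .y j i
  have b₁ := h₂ .x
  have b₂ := h₂ .y
  have b₃ := h₃ .x
  have b₄ := h₃ .y
  have c₁ := h₄ .x
  have c₂ := h₄ .y
  have c₃ := h₅ .x
  have c₄ := h₅ .y
  by_cases d₁ : (isSorted (fun i j => .x i j) l).value ans = true
  · simp [trySorted, d₁]
    omega
  by_cases d₂ : (isSorted (fun i j => .x j i) l).value ans = true
  · simp [trySorted, d₁, d₂]
    omega
  by_cases d₃ : (isSorted (fun i j => .y i j) l).value ans = true
  · simp [trySorted, d₁, d₂, d₃]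
    omega
  by_cases d₄ : (isSorted (fun i j => .y j i) l).value ans = true
  · simp [trySorted, d₁, d₂, d₃, d₄]
    omega
  · simp [trySorted, d₁, d₂, d₃, d₄]
    omega

theorem value_trySorted (ans : CoordTest n → Bool) (l : List (Fin n)) :
    (trySorted l).value ans = true ↔
      l.IsChain (fun i j => ans (.x i j) = true) ∨ l.IsChain (fun i j => ans (.x j i) = true) ∨
      l.IsChain (fun i j => ans (.y i j) = true) ∨ l.IsChain (fun i j => ans (.y j i) = true) := by
  simp only [← value_isSorted]
  by_cases d₁ : (isSorted (fun i j => .x i j) l).value ans = true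
  · simp [trySorted, d₁]
  by_cases d₂ : (isSorted (fun i j => .x j i) l).value ans = true
  · simp [trySorted, d₁, d₂]
  by_cases d₃ : (isSorted (fun i j => .y i j) l).value ans = true
  · simp [trySorted, d₁, d₂, d₃]
  by_cases d₄ : (isSorted (fun i j => .y j i) l).value ans = true
  · simp [trySorted, d₁, d₂, d₃, d₄]
  · simp [trySorted, d₁, d₂, d₃, d₄]

theorem write_trySorted_of_false (ans : CoordTest n → Bool) (l : List (Fin n))
    (h : (trySorted l).value ans = false) (o : Output n) : (trySorted l).write ans o = o := by
  have h' := (value_trySorted ans l).not.1 (by simp [h])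
  simp only [not_or, ← value_isSorted] at h'
  simp [trySorted, h']

theorem pairwise_of_isChain {u : Fin n → ℝ} {l : List (Fin n)}
    (h : l.IsChain fun i j => u i < u j) : l.Pairwise fun i j => u i < u j := by
  have : IsTrans (Fin n) fun i j => u i < u j := ⟨fun _ _ _ => lt_trans⟩
  exact List.isChain_iff_pairwise.1 h

/-- When the list is sorted by y, the sweep returns a front with increasing y, hence with decreasing
x; this is why these two cases reverse it before emitting. -/
theorem solves_trySorted (hx : Function.Injective fun i => (I i).1)
    (hy : Function.Injective fun i => (I i).2) (l : List (Fin n))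
    (h : (trySorted l).value (CoordTest.eval I) = true) : Solves I l (trySorted l) := by
  have hd := dominates_iff hx hy
  have hd' : ∀ i j, Dominates (I j) (I i) ↔ (I i).2 < (I j).2 ∧ (I i).1 < (I j).1 :=
    fun i j => (hd i j).trans and_comm
  have sx := sweepAll_spec (lt := .y) (fun i j => rfl) hy hd
  have sy := sweepAll_spec (lt := .x) (fun i j => rfl) hx hd'
  have tr : ∀ {u : Fin n → ℝ} {l : List (Fin n)} (h : l.IsChain fun i j => u j < u i),
      l.Pairwise fun i j => u j < u i := by
    intro u l h
    have : IsTrans (Fin n) fun i j => u j < u i := ⟨fun _ _ _ a b => lt_trans b a⟩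
    exact List.isChain_iff_pairwise.1 h
  intro o
  by_cases h₁ : (isSorted (fun i j => .x i j) l).value (CoordTest.eval I) = true
  · have hs := (value_isSorted _ _ _).1 h₁
    simp only [CoordTest.eval, decide_eq_true_eq] at hs
    obtain ⟨p, f, w⟩ := sx l.reverse (List.pairwise_reverse.2 (pairwise_of_isChain hs))
    simp only [trySorted, Prog.write_bind, h₁, if_true, value_rev, List.append_nil, write_tick,
      write_isSorted, write_rev, write_emit, Prog.write_pure]
    refine ⟨_, by rw [(w o).1], p.imp And.left, f.congr (by simp) (by simp),
      (w o).2.congr (by simp) (by simp)⟩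
  by_cases h₂ : (isSorted (fun i j => .x j i) l).value (CoordTest.eval I) = true
  · have hs := (value_isSorted _ _ _).1 h₂
    simp only [CoordTest.eval, decide_eq_true_eq] at hs
    obtain ⟨p, f, w⟩ := sx l (tr hs)
    simp only [trySorted, Prog.write_bind, h₁, h₂, if_true, write_tick,
      write_isSorted, write_emit, Prog.write_pure, if_false, Bool.false_eq_true]
    exact ⟨_, by rw [(w o).1], p.imp And.left, f, (w o).2⟩
  by_cases h₃ : (isSorted (fun i j => .y i j) l).value (CoordTest.eval I) = true
  · have hs := (value_isSorted _ _ _).1 h₃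
    simp only [CoordTest.eval, decide_eq_true_eq] at hs
    obtain ⟨p, f, w⟩ := sy l.reverse (List.pairwise_reverse.2 (pairwise_of_isChain hs))
    simp only [trySorted, Prog.write_bind, h₁, h₂, h₃, if_true, value_rev, List.append_nil,
      write_tick, write_isSorted, write_rev, write_emit, Prog.write_pure, if_false,
      Bool.false_eq_true]
    exact ⟨_, by rw [(w o).1], List.pairwise_reverse.2 (p.imp And.right),
      f.congr (by simp) (by simp), (w o).2.congr (by simp) (by simp)⟩
  by_cases h₄ : (isSorted (fun i j => .y j i) l).value (CoordTest.eval I) = true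
  · have hs := (value_isSorted _ _ _).1 h₄
    simp only [CoordTest.eval, decide_eq_true_eq] at hs
    obtain ⟨p, f, w⟩ := sy l (tr hs)
    simp only [trySorted, Prog.write_bind, h₁, h₂, h₃, h₄, if_true, value_rev, List.append_nil,
      write_tick, write_isSorted, write_rev, write_emit, Prog.write_pure, if_false,
      Bool.false_eq_true]
    exact ⟨_, by rw [(w o).1], List.pairwise_reverse.2 (p.imp And.right),
      f.congr (by simp) (by simp), (w o).2.congr (by simp) (by simp)⟩
  · rw [value_trySorted] at h
    simp only [← value_isSorted] at h
    tauto

/-- The representative is the highest of the points that are not to the left of `m`. -/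
theorem value_representative (m : Fin n) (q : Fin n) (l : List (Fin n))
    (hq : (I m).1 ≤ (I q).1) :
    ((representative m q l).value (CoordTest.eval I) ∈ q :: l) ∧
    (I m).1 ≤ (I ((representative m q l).value (CoordTest.eval I))).1 ∧
    ∀ i ∈ q :: l, (I m).1 ≤ (I i).1 →
      (I i).2 ≤ (I ((representative m q l).value (CoordTest.eval I))).2 := by
  induction l generalizing q with
  | nil => simp [representative, hq]
  | cons i l ih =>
    by_cases h₁ : (I i).1 < (I m).1
    · obtain ⟨a, b, c⟩ := ih q hq
      simp only [representative, Prog.value_bind, value_ask, CoordTest.eval, h₁, decide_true,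
        if_true]
      refine ⟨?_, b, fun k hk hk' => ?_⟩
      · rcases List.mem_cons.1 a with a | a <;> simp [a]
      · have hki : k ≠ i := by rintro rfl; exact absurd hk' (not_le.2 h₁)
        exact c k (by simpa [hki] using hk) hk'
    · by_cases h₂ : (I q).2 < (I i).2
      · obtain ⟨a, b, c⟩ := ih i (not_lt.1 h₁)
        simp only [representative, Prog.value_bind, value_ask, CoordTest.eval, h₁, h₂,
          decide_true, decide_false, if_true, if_false, Bool.false_eq_true]
        refine ⟨List.mem_cons_of_mem _ a, b, fun k hk hk' => ?_⟩
        rcases List.mem_cons.1 hk with rfl | hk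
        · exact h₂.le.trans (c i (by simp) (not_lt.1 h₁))
        · exact c k hk hk'
      · obtain ⟨a, b, c⟩ := ih q hq
        simp only [representative, Prog.value_bind, value_ask, CoordTest.eval, h₁, h₂,
          decide_false, if_false, Bool.false_eq_true]
        refine ⟨?_, b, fun k hk hk' => ?_⟩
        · rcases List.mem_cons.1 a with a | a <;> simp [a]
        · rcases List.mem_cons.1 hk with rfl | hk
          · exact c _ (by simp) hk'
          · rcases List.mem_cons.1 hk with rfl | hk
            · exact (not_lt.1 h₂).trans (c q (by simp) hq)
            · exact c k (by simp [hk]) hk'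

theorem cost_representative_le (ans : CoordTest n → Bool) (m q : Fin n) (l : List (Fin n)) :
    (representative m q l).cost ans ≤ 3 * l.length + 1 := by
  induction l generalizing q with
  | nil => simp [representative]
  | cons i l ih =>
    have h₁ := ih q
    have h₂ := ih i
    by_cases d₁ : ans (.x i m) = true
    · simp [representative, d₁]
      omega
    by_cases d₂ : ans (.y q i) = true <;> simp [representative, d₁, d₂] <;> omega

@[simp] theorem write_representative (ans : CoordTest n → Bool) (m q : Fin n) (l : List (Fin n))
    (o : Output n) : (representative m q l).write ans o = o := by
  induction l generalizing q with
  | nil => simp [representative]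
  | cons i l ih =>
    by_cases d₁ : ans (.x i m) = true
    · simp [representative, d₁, ih]
    by_cases d₂ : ans (.y q i) = true <;> simp [representative, d₁, d₂, ih]

theorem cost_discard_le (ans : CoordTest n → Bool) (q : Fin n) (l : List (Fin n)) :
    (discard q l).cost ans ≤ 4 * l.length + 1 := by
  induction l with
  | nil => simp [discard]
  | cons i l ih =>
    by_cases d₁ : ans (.y q i) = true
    · simp [discard, d₁]
      omega
    by_cases d₂ : ans (.x q i) = true
    · simp [discard, d₁, d₂]
      omega
    by_cases d₃ : i = q
    · subst d₃
      simp [discard, d₁]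
      omega
    · simp [discard, d₁, d₂, d₃]
      omega

theorem write_discard (q : Fin n) (l : List (Fin n)) (o : Output n) :
    ((discard q l).write (CoordTest.eval I) o).front = o.front ∧
    ∀ i, ((discard q l).write (CoordTest.eval I) o).witness i =
      if i ∈ l ∧ (I i).2 ≤ (I q).2 ∧ (I i).1 ≤ (I q).1 ∧ i ≠ q then some q else o.witness i := by
  induction l generalizing o with
  | nil => simp [discard]
  | cons i l ih =>
    by_cases h₁ : (I q).2 < (I i).2
    · simp only [discard, Prog.write_bind, write_tick, write_ask, value_ask, CoordTest.eval, h₁,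
        decide_true, if_true]
      refine ⟨(ih o).1, fun k => ?_⟩
      rw [(ih o).2 k]
      refine if_congr (and_congr_left fun h => ?_) rfl rfl
      have : k ≠ i := by rintro rfl; exact absurd h.1 (not_le.2 h₁)
      simp [this]
    by_cases h₂ : (I q).1 < (I i).1
    · simp only [discard, Prog.write_bind, write_tick, write_ask, value_ask, CoordTest.eval, h₁,
        h₂, decide_true, if_true, decide_false, if_false, Bool.false_eq_true]
      refine ⟨(ih o).1, fun k => ?_⟩
      rw [(ih o).2 k]
      refine if_congr (and_congr_left fun h => ?_) rfl rfl
      have : k ≠ i := by rintro rfl; exact absurd h.2.1 (not_le.2 h₂)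
      simp [this]
    by_cases h₃ : i = q
    · simp only [discard, Prog.write_bind, write_tick, write_ask, value_ask, CoordTest.eval, h₁,
        h₂, if_pos h₃, decide_false, if_false, Bool.false_eq_true]
      refine ⟨(ih o).1, fun k => ?_⟩
      rw [(ih o).2 k]
      refine if_congr (and_congr_left fun h => ?_) rfl rfl
      have : k ≠ i := by rintro rfl; exact h.2.2 h₃
      simp [this]
    · simp only [discard, Prog.write_bind, write_tick, write_ask, value_ask, CoordTest.eval, h₁,
        h₂, if_neg h₃, decide_false, if_false, Bool.false_eq_true, write_addWitness]
      refine ⟨(ih _).1, fun k => ?_⟩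
      rw [(ih _).2 k]
      by_cases hk : k = i
      · subst hk
        simp [not_lt.1 h₁, not_lt.1 h₂, h₃]
      · simp [hk]

end Correctness

/-! ### Correctness of the recursion -/

section Recursion

variable {n : ℕ} {I : Input n}

theorem value_trySorted_nil (ans : CoordTest n → Bool) :
    (trySorted ([] : List (Fin n))).value ans = true := by
  simp [value_trySorted]

/-- One level of the recursion on a list that is not sorted. -/
theorem paretoRec_succ (hx : Function.Injective fun i => (I i).1) (l : List (Fin n))
    (hl : l.Nodup) (hs : (trySorted l).value (CoordTest.eval I) = false) :
    ∃ m ∈ l, ∃ q ∈ l, l.countP (fun i => decide ((I i).1 < (I m).1)) = l.length / 2 ∧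
      (I m).1 ≤ (I q).1 ∧ (∀ i ∈ l, (I m).1 ≤ (I i).1 → (I i).2 ≤ (I q).2) ∧
      ∀ fuel l₁ l₂, l₁ = l.filter (fun i => decide ((I q).2 < (I i).2)) →
        l₂ = l.filter (fun i => decide ((I q).1 < (I i).1)) →
        (∀ o, (paretoRec (fuel + 1) l).write (CoordTest.eval I) o =
          (paretoRec fuel l₂).write (CoordTest.eval I)
            ((addFront q).write (CoordTest.eval I)
              ((paretoRec fuel l₁).write (CoordTest.eval I)
                ((discard q l).write (CoordTest.eval I) o)))) ∧
        (paretoRec (fuel + 1) l).cost (CoordTest.eval I) ≤ 2040 * (l.length + 1) +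
          (paretoRec fuel l₁).cost (CoordTest.eval I) +
          (paretoRec fuel l₂).cost (CoordTest.eval I) := by
  have hlen : 0 < l.length := by
    rw [List.length_pos_iff]
    rintro rfl
    simp [value_trySorted_nil] at hs
  obtain ⟨⟨m, hm, hv, hr⟩, hc⟩ := selectRank_spec I hx l.length l (l.length / 2) hl le_rfl
    (by omega)
  obtain ⟨h₁, h₂, h₃⟩ := value_representative (I := I) m m l le_rfl
  have c₁ := cost_trySorted_le (CoordTest.eval I) l
  have c₂ := cost_representative_le (CoordTest.eval I) m m l
  set q := (representative m m l).value (CoordTest.eval I) with hq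
  have c₃ := cost_discard_le (CoordTest.eval I) q l
  refine ⟨m, hm, q, (List.mem_cons.1 h₁).elim (fun h => h ▸ hm) id, hr, h₂,
    fun i hi => h₃ i (List.mem_cons_of_mem _ hi), ?_⟩
  rintro fuel l₁ l₂ rfl rfl
  constructor
  · intro o
    simp [paretoRec, hs, hv, ← hq, write_trySorted_of_false, CoordTest.eval]
  · simp [paretoRec, hs, hv, ← hq, CoordTest.eval]
    omega

theorem paretoRec_succ_of_sorted (fuel : ℕ) (l : List (Fin n))
    (hs : (trySorted l).value (CoordTest.eval I) = true) :
    (∀ o, (paretoRec (fuel + 1) l).write (CoordTest.eval I) o =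
      (trySorted l).write (CoordTest.eval I) o) ∧
    (paretoRec (fuel + 1) l).cost (CoordTest.eval I) ≤ 2040 * (l.length + 1) := by
  have c₁ := cost_trySorted_le (CoordTest.eval I) l
  constructor
  · intro o
    simp [paretoRec, hs]
  · simp [paretoRec, hs]
    omega

theorem length_filter_lt_of_mem {α : Type*} {p : α → Bool} {l : List α} {a : α} (ha : a ∈ l)
    (hp : p a = false) : (l.filter p).length < l.length :=
  List.length_filter_lt_length_iff_exists.2 ⟨a, ha, by simp [hp]⟩

/-- A point above `q` is left of the median, since `q` is highest on the other side; a point right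
of `q` is below it. A dominator of a point above `q` is again above `q`, and likewise to the right,
so the fronts of `l₁` and `l₂` are fronts within `l`, and placing `q` between them gives increasing
x. The two sublists and the discarded points are disjoint, so the three groups of witness writes do
not interfere. -/
theorem solves_paretoRec (hx : Function.Injective fun i => (I i).1)
    (hy : Function.Injective fun i => (I i).2) (fuel : ℕ) (l : List (Fin n)) (hl : l.Nodup)
    (hfuel : l.length ≤ fuel) : Solves I l (paretoRec fuel l) := by
  induction fuel generalizing l with
  | zero =>
    obtain rfl : l = [] := List.length_eq_zero_iff.1 (by omega)
    exact fun o => ⟨[], by simp [paretoRec, IsFrontOf, AddsWitnesses]⟩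
  | succ fuel ih =>
    rcases hs : (trySorted l).value (CoordTest.eval I) with _ | _
    swap
    · intro o
      rw [(paretoRec_succ_of_sorted fuel l hs).1]
      exact solves_trySorted hx hy l hs o
    obtain ⟨m, hm, q, hq, -, hmq, hqmax, h⟩ := paretoRec_succ hx l hl hs
    set l₁ := l.filter fun i => decide ((I q).2 < (I i).2) with hl₁
    set l₂ := l.filter fun i => decide ((I q).1 < (I i).1) with hl₂
    have s₁ : Solves I l₁ (paretoRec fuel l₁) := ih l₁ (hl.filter _) (by
      have := length_filter_lt_of_mem (p := fun i => decide ((I q).2 < (I i).2)) hq (by simp)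
      rw [← hl₁] at this
      omega)
    have s₂ : Solves I l₂ (paretoRec fuel l₂) := ih l₂ (hl.filter _) (by
      have := length_filter_lt_of_mem (p := fun i => decide ((I q).1 < (I i).1)) hq (by simp)
      rw [← hl₂] at this
      omega)
    have hd := dominates_iff hx hy
    have m₁ : ∀ i, i ∈ l₁ ↔ i ∈ l ∧ (I q).2 < (I i).2 := fun i => by simp [hl₁]
    have m₂ : ∀ i, i ∈ l₂ ↔ i ∈ l ∧ (I q).1 < (I i).1 := fun i => by simp [hl₂]
    have above : ∀ i ∈ l, (I q).2 < (I i).2 → (I i).1 < (I q).1 := fun i hi h' =>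
      (lt_of_not_ge fun h'' => absurd (hqmax i hi h'') (not_le.2 h')).trans_le hmq
    have right : ∀ i ∈ l, (I q).1 < (I i).1 → (I i).2 ≤ (I q).2 := fun i hi h' =>
      hqmax i hi (hmq.trans h'.le)
    intro o
    rw [(h fuel l₁ l₂ rfl rfl).1]
    obtain ⟨d₁, d₂⟩ := write_discard (I := I) q l o
    set o₁ := (discard q l).write (CoordTest.eval I) o
    obtain ⟨F₁, f₁, p₁, e₁, w₁, w₁'⟩ := s₁ o₁
    set o₂ := (paretoRec fuel l₁).write (CoordTest.eval I) o₁
    rw [write_addFront]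
    obtain ⟨F₂, f₂, p₂, e₂, w₂, w₂'⟩ := s₂ { o₂ with front := o₂.front ++ [q] }
    set o₃ := (paretoRec fuel l₂).write (CoordTest.eval I) { o₂ with front := o₂.front ++ [q] }
    have q₁ : ∀ i ∈ F₁, i ∈ l ∧ (I q).2 < (I i).2 := fun i hi => (m₁ i).1 ((e₁ i).1 hi).1
    have q₂ : ∀ i ∈ F₂, i ∈ l ∧ (I q).1 < (I i).1 := fun i hi => (m₂ i).1 ((e₂ i).1 hi).1
    have hfront : IsFrontOf I l (F₁ ++ q :: F₂) := by
      intro i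
      rw [List.mem_append, List.mem_cons]
      constructor
      · rintro (hi | rfl | hi)
        · refine ⟨(q₁ i hi).1, fun j hj hji => ((e₁ i).1 hi).2 j ((m₁ j).2 ⟨hj, ?_⟩) hji⟩
          exact (q₁ i hi).2.trans ((hd _ _).1 hji).2
        · refine ⟨hq, fun j hj hji => ?_⟩
          rw [hd] at hji
          exact lt_asymm hji.1 (above j hj hji.2)
        · refine ⟨(q₂ i hi).1, fun j hj hji => ((e₂ i).1 hi).2 j ((m₂ j).2 ⟨hj, ?_⟩) hji⟩
          exact (q₂ i hi).2.trans ((hd _ _).1 hji).1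
      · rintro ⟨hi, hi'⟩
        by_cases hi₁ : (I q).2 < (I i).2
        · exact Or.inl ((e₁ i).2 ⟨(m₁ i).2 ⟨hi, hi₁⟩, fun j hj => hi' j ((m₁ j).1 hj).1⟩)
        by_cases hi₂ : (I q).1 < (I i).1
        · exact Or.inr (Or.inr ((e₂ i).2 ⟨(m₂ i).2 ⟨hi, hi₂⟩, fun j hj => hi' j ((m₂ j).1 hj).1⟩))
        · refine Or.inr (Or.inl ?_)
          by_contra hne
          refine hi' q hq ⟨fun h' => hne (hx (congrArg Prod.fst h').symm), not_lt.1 hi₂, not_lt.1 hi₁⟩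
    refine ⟨F₁ ++ q :: F₂, ?_, ?_, hfront, fun i hi => ?_, fun i hi hiF => ?_⟩
    · rw [f₂, f₁, d₁]
      simp
    · rw [List.pairwise_append, List.pairwise_cons]
      refine ⟨p₁, ⟨fun i hi => (q₂ i hi).2, p₂⟩, fun i hi j hj => ?_⟩
      have hi' := above i (q₁ i hi).1 (q₁ i hi).2
      rcases List.mem_cons.1 hj with rfl | hj
      · exact hi'
      · exact hi'.trans (q₂ j hj).2
    · rw [List.mem_append, List.mem_cons] at hi
      -- An index on the front or outside `l` must be left untouched by the second call, by the
      -- first call (`a₁`) and by the discarding step.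
      have a₂ : i ∈ F₂ ∨ i ∉ l₂ := by
        rw [m₂]
        rcases hi with (hi | rfl | hi) | hi
        · exact Or.inr fun h' => lt_asymm h'.2 (above i (q₁ i hi).1 (q₁ i hi).2)
        · exact Or.inr fun h' => lt_irrefl _ h'.2
        · exact Or.inl hi
        · exact Or.inr fun h' => hi h'.1
      have a₁ : i ∈ F₁ ∨ i ∉ l₁ := by
        rw [m₁]
        rcases hi with (hi | rfl | hi) | hi
        · exact Or.inl hi
        · exact Or.inr fun h' => lt_irrefl _ h'.2
        · exact Or.inr fun h' => lt_asymm (q₂ i hi).2 (above i h'.1 h'.2)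
        · exact Or.inr fun h' => hi h'.1
      rw [w₂ i a₂]
      change o₂.witness i = _
      rw [w₁ i a₁, d₂, if_neg]
      rintro ⟨h₁, h₂, h₃, h₄⟩
      rcases hi with (hi | hi | hi) | hi
      · exact absurd h₂ (not_le.2 (q₁ i hi).2)
      · exact h₄ hi
      · exact absurd h₃ (not_le.2 (q₂ i hi).2)
      · exact hi h₁
    · rw [List.mem_append, List.mem_cons, not_or, not_or] at hiF
      by_cases hi₂ : (I q).1 < (I i).1
      · obtain ⟨j, hj, hj'⟩ := w₂' i ((m₂ i).2 ⟨hi, hi₂⟩) hiF.2.2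
        exact ⟨j, ((m₂ j).1 hj).1, hj'⟩
      have a₂ : i ∉ l₂ := fun h' => hi₂ ((m₂ i).1 h').2
      rw [w₂ i (Or.inr a₂)]
      change ∃ j ∈ l, o₂.witness i = some j ∧ _
      by_cases hi₁ : (I q).2 < (I i).2
      · obtain ⟨j, hj, hj'⟩ := w₁' i ((m₁ i).2 ⟨hi, hi₁⟩) hiF.1
        exact ⟨j, ((m₁ j).1 hj).1, hj'⟩
      have a₁ : i ∉ l₁ := fun h' => hi₁ ((m₁ i).1 h').2
      rw [w₁ i (Or.inr a₁), d₂, if_pos ⟨hi, not_lt.1 hi₁, not_lt.1 hi₂, hiF.2.1⟩]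
      exact ⟨q, hq, rfl, fun h' => hiF.2.1 (hx (congrArg Prod.fst h').symm), not_lt.1 hi₂,
        not_lt.1 hi₁⟩

theorem injective_coords {P : Set Point}
    (hP : ∀ p ∈ P, ∀ q ∈ P, p ≠ q → p.1 ≠ q.1 ∧ p.2 ≠ q.2) (hI : Function.Injective I)
    (hIP : ∀ i, I i ∈ P) :
    (Function.Injective fun i => (I i).1) ∧ Function.Injective fun i => (I i).2 := by
  constructor
  · intro i j h
    by_contra hne
    exact (hP _ (hIP i) _ (hIP j) (hI.ne hne)).1 h
  · intro i j h
    by_contra hne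
    exact (hP _ (hIP i) _ (hIP j) (hI.ne hne)).2 h

theorem correct_eppsteinGoodrichIllickanTo : eppsteinGoodrichIllickanTo.Correct := by
  intro n I hI hP
  obtain ⟨hx, hy⟩ := injective_coords hP.1 hI fun i => Set.mem_range_self i
  have hmap : (List.finRange n).map (Fin.castLE le_rfl) ++ [] = List.finRange n := by
    simp
  obtain ⟨F, hF, hpw, hfr, hw, hw'⟩ := solves_paretoRec hx hy n (List.finRange n)
    (List.nodup_finRange n) (by simp) (Output.blank n)
  have hout : (eppsteinGoodrichIllickanTo n).output (CoordTest.eval I) =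
      (paretoRec n (List.finRange n)).write (CoordTest.eval I) (Output.blank n) := by
    simp only [eppsteinGoodrichIllickanTo, Prog.output, Prog.write_bind, value_readInput, hmap,
      write_readInput]
  have hmem : ∀ i, I i ∈ paretoFront (Set.range I) ↔ i ∈ F := by
    intro i
    rw [hfr i]
    simp [paretoFront]
  rw [IsSolution, hout]
  refine ⟨⟨fun p => ?_, ?_⟩, fun i => ⟨fun hi => ?_, fun hi => ?_⟩⟩
  · rw [hF]
    simp only [Output.blank, List.nil_append, List.mem_map]
    constructor
    · rintro ⟨i, hi, rfl⟩
      exact (hmem i).2 hi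
    · intro hp
      obtain ⟨i, rfl⟩ := hp.1
      exact ⟨i, (hmem i).1 hp, rfl⟩
  · rw [hF]
    simpa [Output.blank] using hpw
  · rw [hw i (Or.inl ((hmem i).1 hi))]
    rfl
  · obtain ⟨j, -, hj⟩ := hw' i (List.mem_finRange i) fun h => hi ((hmem i).2 h)
    exact ⟨j, hj⟩

end Recursion

/-! ### The recursion tree -/

section Tree

/-- No two points of `S` have the same x- or y-coordinate. -/
def DistinctCoords (S : Set Point) : Prop :=
  ∀ p ∈ S, ∀ q ∈ S, p ≠ q → p.1 ≠ q.1 ∧ p.2 ≠ q.2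

theorem DistinctCoords.mono {S T : Set Point} (hT : DistinctCoords T) (h : S ⊆ T) :
    DistinctCoords S := fun p hp q hq => hT p (h hp) q (h hq)

/-- `q` is the highest of the points of `S` that are not to the left of the median. -/
def IsRep (S : Finset Point) (q : Point) : Prop :=
  ∃ m ∈ S, (S.filter fun p => p.1 < m.1).card = S.card / 2 ∧ q ∈ S ∧ m.1 ≤ q.1 ∧
    ∀ p ∈ S, m.1 ≤ p.1 → p.2 ≤ q.2

theorem eq_of_card_filter_lt_eq {S : Finset Point} (hS : DistinctCoords (S : Set Point))
    {m m' : Point} (hm : m ∈ S) (hm' : m' ∈ S)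
    (h : (S.filter fun p => p.1 < m.1).card = (S.filter fun p => p.1 < m'.1).card) : m = m' := by
  have key : ∀ a b : Point, a ∈ S → a.1 < b.1 →
      (S.filter fun p => p.1 < a.1).card < (S.filter fun p => p.1 < b.1).card := by
    intro a b ha hab
    refine Finset.card_lt_card ⟨fun p hp => ?_, fun hsub => ?_⟩
    · rw [Finset.mem_filter] at hp ⊢
      exact ⟨hp.1, hp.2.trans hab⟩
    · exact lt_irrefl _ (Finset.mem_filter.1 (hsub (Finset.mem_filter.2 ⟨ha, hab⟩))).2
  by_contra hne
  rcases lt_or_gt_of_ne (hS m hm m' hm' hne).1 with h' | h'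
  · exact (key m m' hm h').ne h
  · exact (key m' m hm' h').ne' h

/-- This makes the recursion tree a function of the point set alone, so all inputs of a universe
share one tree. -/
theorem IsRep.unique {S : Finset Point} (hS : DistinctCoords (S : Set Point)) {q q' : Point}
    (h : IsRep S q) (h' : IsRep S q') : q = q' := by
  obtain ⟨m, hm, hc, hq, hmq, hmax⟩ := h
  obtain ⟨m', hm', hc', hq', hmq', hmax'⟩ := h'
  obtain rfl : m = m' := eq_of_card_filter_lt_eq hS hm hm' (hc.trans hc'.symm)
  by_contra hne
  exact (hS q hq q' hq' hne).2 (le_antisymm (hmax' q hq hmq) (hmax q' hq' hmq'))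

/-- The x-coordinate (`true`) or the y-coordinate (`false`). -/
def coord (b : Bool) (p : Point) : ℝ := bif b then p.1 else p.2

@[simp] theorem coord_true (p : Point) : coord true p = p.1 := rfl

@[simp] theorem coord_false (p : Point) : coord false p = p.2 := rfl

open scoped Classical in
/-- The two subproblems of `S`: the points above (`false`) and the points to the right (`true`) of
the representative. -/
noncomputable def child (b : Bool) (S : Finset Point) : Finset Point :=
  S.filter fun p => ∃ q, IsRep S q ∧ coord b q < coord b p

theorem mem_child {b : Bool} {S : Finset Point} {p : Point} :
    p ∈ child b S ↔ p ∈ S ∧ ∃ q, IsRep S q ∧ coord b q < coord b p := by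
  classical
  exact Finset.mem_filter

theorem child_subset (b : Bool) (S : Finset Point) : child b S ⊆ S :=
  fun _ hp => (mem_child.1 hp).1

theorem mem_child_iff {S : Finset Point} (hS : DistinctCoords (S : Set Point)) {q : Point}
    (hq : IsRep S q) (b : Bool) (p : Point) :
    p ∈ child b S ↔ p ∈ S ∧ coord b q < coord b p := by
  rw [mem_child]
  refine and_congr_right fun _ => ⟨?_, fun h => ⟨q, hq, h⟩⟩
  rintro ⟨q', hq', h⟩
  rwa [IsRep.unique hS hq hq']

theorem exists_isRep_of_mem_child {b : Bool} {S : Finset Point} {p : Point} (hp : p ∈ child b S) :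
    ∃ q, IsRep S q := by
  obtain ⟨-, q, hq, -⟩ := mem_child.1 hp
  exact ⟨q, hq⟩

theorem child_upward {b : Bool} {S : Finset Point} {p f : Point} (hp : p ∈ child b S) (hf : f ∈ S)
    (h₁ : p.1 ≤ f.1) (h₂ : p.2 ≤ f.2) : f ∈ child b S := by
  obtain ⟨-, q, hq, h⟩ := mem_child.1 hp
  refine mem_child.2 ⟨hf, q, hq, ?_⟩
  cases b
  · exact lt_of_lt_of_le (by simpa using h) h₂
  · exact lt_of_lt_of_le (by simpa using h) h₁

/-- A point above the representative lies left of the median, or the representative would not be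
highest. A point to the right of the representative is also right of the median, hence not higher
than the representative. -/
theorem child_separated {S : Finset Point} (hS : DistinctCoords (S : Set Point)) {a b : Point}
    (ha : a ∈ child false S) (hb : b ∈ child true S) : a.1 < b.1 ∧ b.2 < a.2 := by
  obtain ⟨q, hq⟩ := exists_isRep_of_mem_child ha
  rw [mem_child_iff hS hq] at ha hb
  obtain ⟨m, -, -, -, hmq, hmax⟩ := hq
  obtain ⟨ha, haq⟩ := ha
  obtain ⟨hb, hbq⟩ := hb
  simp only [coord_false, coord_true] at haq hbq
  have h₁ : a.1 < m.1 := lt_of_not_ge fun h => absurd (hmax a ha h) (not_le.2 haq)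
  exact ⟨h₁.trans_le (hmq.trans hbq.le), (hmax b hb (hmq.trans hbq.le)).trans_lt haq⟩

/-- The points above the representative are among those strictly left of the median, and the points
to its right are strictly right of the median. -/
theorem card_child_le {S : Finset Point} (hS : DistinctCoords (S : Set Point)) (b : Bool) :
    (child b S).card ≤ S.card / 2 := by
  rcases (child b S).eq_empty_or_nonempty with h | ⟨p, hp⟩
  · simp [h]
  obtain ⟨q, hq⟩ := exists_isRep_of_mem_child hp
  have hmem := mem_child_iff hS hq b
  obtain ⟨m, hm, hc, -, hmq, hmax⟩ := hq
  cases b with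
  | false =>
    rw [← hc]
    refine Finset.card_le_card fun a ha => ?_
    have ha' := (hmem a).1 ha
    simp only [coord_false] at ha'
    exact Finset.mem_filter.2 ⟨ha'.1, lt_of_not_ge fun h =>
      absurd (hmax a ha'.1 h) (not_le.2 ha'.2)⟩
  | true =>
    have hsub : child true S ⊆ (S.filter fun p => ¬ p.1 < m.1).erase m := by
      intro a ha
      have ha' := (hmem a).1 ha
      simp only [coord_true] at ha'
      have hlt := hmq.trans_lt ha'.2
      refine Finset.mem_erase.2 ⟨fun h => by simp [h] at hlt, Finset.mem_filter.2 ⟨ha'.1, ?_⟩⟩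
      exact not_lt.2 hlt.le
    have h₁ := Finset.card_le_card hsub
    rw [Finset.card_erase_of_mem (by simp [hm])] at h₁
    have h₂ := Finset.card_filter_add_card_filter_not (s := S) fun p => p.1 < m.1
    omega

/-- The node of the recursion tree below `S` with address `w`. -/
noncomputable def node (S : Finset Point) : List Bool → Finset Point
  | [] => S
  | b :: w => node (child b S) w

theorem node_subset (S : Finset Point) (w : List Bool) : node S w ⊆ S := by
  induction w generalizing S with
  | nil => exact subset_rfl
  | cons b w ih => exact (ih _).trans (child_subset b S)

theorem distinctCoords_child {S : Finset Point} (hS : DistinctCoords (S : Set Point)) (b : Bool) :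
    DistinctCoords (child b S : Set Point) :=
  hS.mono (Finset.coe_subset.2 (child_subset b S))

theorem card_node_mul_le {S : Finset Point} (hS : DistinctCoords (S : Set Point))
    (w : List Bool) : (node S w).card * 2 ^ w.length ≤ S.card := by
  induction w generalizing S with
  | nil => simp [node]
  | cons b w ih =>
    have h₁ := ih (distinctCoords_child hS b)
    have h₂ := card_child_le hS b
    rw [node, List.length_cons, pow_succ, ← mul_assoc]
    omega

/-- Used with `f` a common dominator of the points stored at one position: all their nodes then
contain `f`. -/
theorem node_upward {S : Finset Point} {w : List Bool} {p f : Point} (hp : p ∈ node S w)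
    (hf : f ∈ S) (h₁ : p.1 ≤ f.1) (h₂ : p.2 ≤ f.2) : f ∈ node S w := by
  induction w generalizing S with
  | nil => exact hf
  | cons b w ih => exact ih hp (child_upward (node_subset _ _ hp) hf h₁ h₂)

/-- All points of the node `w` lie to the left of and above all points of the node `w'`. -/
def LeftOf (S : Finset Point) (w w' : List Bool) : Prop :=
  ∀ a ∈ node S w, ∀ b ∈ node S w', a.1 < b.1 ∧ b.2 < a.2

/-- At the first letter where the addresses differ, the nodes pass into different children, which
are separated. So the nodes of one level form a staircase descending to the right. -/
theorem leftOf_or_leftOf {S : Finset Point} (hS : DistinctCoords (S : Set Point))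
    {w w' : List Bool} (hlen : w.length = w'.length) (hne : w ≠ w') :
    LeftOf S w w' ∨ LeftOf S w' w := by
  induction w generalizing S w' with
  | nil =>
    cases w' with
    | nil => exact absurd rfl hne
    | cons b' w' => simp at hlen
  | cons b w ih =>
    cases w' with
    | nil => simp at hlen
    | cons b' w' =>
      by_cases hb : b = b'
      · subst hb
        exact ih (distinctCoords_child hS b) (by simpa using hlen) fun h => hne (by rw [h])
      · have hsub := fun b w => node_subset (child b S) w
        rcases b with _ | _ <;> rcases b' with _ | _
        · exact absurd rfl hb
        · exact Or.inl fun p hp q hq => child_separated hS (hsub _ _ hp) (hsub _ _ hq)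
        · exact Or.inr fun p hp q hq => child_separated hS (hsub _ _ hp) (hsub _ _ hq)
        · exact absurd rfl hb

theorem eq_of_mem_node {S : Finset Point} (hS : DistinctCoords (S : Set Point))
    {w w' : List Bool} (hlen : w.length = w'.length) {p : Point} (h : p ∈ node S w)
    (h' : p ∈ node S w') : w = w' := by
  by_contra hne
  rcases leftOf_or_leftOf hS hlen hne with hl | hl
  · exact lt_irrefl _ (hl p h p h').1
  · exact lt_irrefl _ (hl p h' p h).1

/-! ### Classes, mixed nodes and addresses -/

variable {κ : Type*} (c : Point → κ)

/-- `S` contains points of two different classes. -/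
def Mixed (S : Finset Point) : Prop := ∃ p ∈ S, ∃ q ∈ S, c p ≠ c q

open scoped Classical in
/-- The address of the deepest mixed node that contains `p` (up to a given depth). -/
noncomputable def address : ℕ → Finset Point → Point → List Bool
  | 0, _, _ => []
  | k + 1, S, p =>
    if p ∈ child false S ∧ Mixed c (child false S) then false :: address k (child false S) p
    else if p ∈ child true S ∧ Mixed c (child true S) then true :: address k (child true S) p
    else []

open scoped Classical in
/-- The total size of the mixed nodes (up to a given depth). -/
noncomputable def mixedSize : ℕ → Finset Point → ℕ
  | 0, _ => 0
  | k + 1, S =>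
    if Mixed c S then S.card + mixedSize k (child false S) + mixedSize k (child true S) else 0

theorem mem_node_address (k : ℕ) (S : Finset Point) (p : Point) (hp : p ∈ S) :
    p ∈ node S (address c k S p) := by
  induction k generalizing S with
  | zero => exact hp
  | succ k ih =>
    rw [address]
    split_ifs with h₁ h₂
    · exact ih _ h₁.1
    · exact ih _ h₂.1
    · exact hp

/-- The empty address is excluded because it is also the default value when the root itself is not
mixed. -/
theorem mixed_node_address (k : ℕ) (S : Finset Point) (p : Point)
    (hne : address c k S p ≠ []) : Mixed c (node S (address c k S p)) := by
  induction k generalizing S with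
  | zero => simp [address] at hne
  | succ k ih =>
    rw [address] at hne ⊢
    split_ifs with h₁ h₂
    · rw [node]
      by_cases h : address c k (child false S) p = []
      · rw [h]
        exact h₁.2
      · exact ih _ h
    · rw [node]
      by_cases h : address c k (child true S) p = []
      · rw [h]
        exact h₂.2
      · exact ih _ h
    · simp [h₁, h₂] at hne

theorem mixedSize_eq_zero (k : ℕ) {S : Finset Point} (h : ¬ Mixed c S) : mixedSize c k S = 0 := by
  cases k with
  | zero => rfl
  | succ k => simp [mixedSize, h]

/-- Double counting: the mixed nodes containing `p` are the prefixes of its address, because an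
ancestor of a mixed node is mixed. In the induction, the address of a point of a mixed child is one
letter longer than its address inside that child. -/
theorem mixedSize_le (k : ℕ) (S : Finset Point) (hS : DistinctCoords (S : Set Point)) :
    mixedSize c k S ≤ ∑ p ∈ S, ((address c k S p).length + 1) := by
  induction k generalizing S with
  | zero => simp [mixedSize]
  | succ k ih =>
    rw [mixedSize]
    split_ifs
    swap
    · exact Nat.zero_le _
    have hdisj : Disjoint (child false S) (child true S) :=
      Finset.disjoint_left.2 fun p h h' => lt_irrefl _ (child_separated hS h h').1
    have key : ∀ b, mixedSize c k (child b S) ≤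
        ∑ p ∈ child b S, (address c (k + 1) S p).length := by
      intro b
      by_cases hm : Mixed c (child b S)
      · refine (ih _ (distinctCoords_child hS b)).trans (Finset.sum_le_sum fun p hp => ?_)
        cases b with
        | false => simp [address, hp, hm]
        | true => simp [address, hp, hm, Finset.disjoint_right.1 hdisj hp]
      · simp [mixedSize_eq_zero c k hm]
    have h₁ : ∑ p ∈ child false S ∪ child true S, (address c (k + 1) S p).length ≤
        ∑ p ∈ S, (address c (k + 1) S p).length :=
      Finset.sum_le_sum_of_subset
        (Finset.union_subset (child_subset false S) (child_subset true S))
    rw [Finset.sum_union hdisj] at h₁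
    rw [Finset.sum_add_distrib, Finset.sum_const, smul_eq_mul, mul_one]
    have := key false
    have := key true
    omega

/-- Every class that meets both of two points contains the points of the box between them. -/
def BoxConvex (S : Finset Point) : Prop :=
  ∀ a ∈ S, ∀ b ∈ S, ∀ d ∈ S, a ≠ d → c a = c d → a.1 < b.1 → b.1 < d.1 → d.2 < b.2 → b.2 < a.2 →
    c b = c a

/-- At most two mixed nodes of each depth meet a given class. -/
theorem card_addresses_le_two [DecidableEq κ] {S : Finset Point}
    (hS : DistinctCoords (S : Set Point)) (hc : BoxConvex c S) (k d : ℕ) (a : κ) :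
    (((S.filter fun p => c p = a).image (address c k S)).filter
      fun w => w.length = d).card ≤ 2 := by
  by_contra! hcard
  obtain ⟨w₁, h₁, w₂, h₂, w₃, h₃, h₁₂, h₁₃, h₂₃⟩ := Finset.two_lt_card.1 hcard
  have hmem : ∀ w ∈ ((S.filter fun p => c p = a).image (address c k S)).filter
      fun w => w.length = d, (∃ p ∈ node S w, c p = a) ∧ w.length = d ∧
        (w ≠ [] → Mixed c (node S w)) := by
    intro w hw
    rw [Finset.mem_filter, Finset.mem_image] at hw
    obtain ⟨⟨p, hp, rfl⟩, hd⟩ := hw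
    rw [Finset.mem_filter] at hp
    exact ⟨⟨p, mem_node_address c k S p hp.1, hp.2⟩, hd, mixed_node_address c k S p⟩
  obtain ⟨p₁, l₁, m₁⟩ := hmem w₁ h₁
  obtain ⟨p₂, l₂, m₂⟩ := hmem w₂ h₂
  obtain ⟨p₃, l₃, m₃⟩ := hmem w₃ h₃
  -- At depth 0 there is only one address; below it, all three nodes are mixed.
  have hd : d ≠ 0 := by
    rintro rfl
    exact h₁₂ ((List.length_eq_zero_iff.1 l₁).trans (List.length_eq_zero_iff.1 l₂).symm)
  have ne : ∀ w : List Bool, w.length = d → w ≠ [] := by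
    rintro _ h rfl
    exact hd h.symm
  -- The middle one of three nodes lies in the box between a point of class `a` in the first and one
  -- in the last, so it is entirely of class `a` and not mixed. The case distinction below only
  -- identifies the middle node.
  have key : ∀ u v w : List Bool, LeftOf S u v → LeftOf S v w → (∃ p ∈ node S u, c p = a) →
      (∃ p ∈ node S w, c p = a) → Mixed c (node S v) → False := by
    rintro u v w huv hvw ⟨p, hp, hpa⟩ ⟨q, hq, hqa⟩ ⟨x, hx, y, hy, hxy⟩
    have h : ∀ b ∈ node S v, c b = a := by
      intro b hb
      have b₁ := huv p hp b hb
      have b₂ := hvw b hb q hq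
      rw [← hpa]
      refine hc p (node_subset _ _ hp) b (node_subset _ _ hb) q (node_subset _ _ hq) ?_
        (hpa.trans hqa.symm) b₁.1 b₂.1 b₂.2 b₁.2
      rintro rfl
      exact lt_asymm b₁.1 b₂.1
    exact hxy ((h x hx).trans (h y hy).symm)
  have n₁ := m₁ (ne _ l₁)
  have n₂ := m₂ (ne _ l₂)
  have n₃ := m₃ (ne _ l₃)
  rcases leftOf_or_leftOf hS (l₁.trans l₂.symm) h₁₂ with o₁ | o₁ <;>
    rcases leftOf_or_leftOf hS (l₂.trans l₃.symm) h₂₃ with o₂ | o₂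
  · exact key _ _ _ o₁ o₂ p₁ p₃ n₂
  · rcases leftOf_or_leftOf hS (l₁.trans l₃.symm) h₁₃ with o₃ | o₃
    · exact key _ _ _ o₃ o₂ p₁ p₂ n₃
    · exact key _ _ _ o₃ o₁ p₃ p₂ n₁
  · rcases leftOf_or_leftOf hS (l₁.trans l₃.symm) h₁₃ with o₃ | o₃
    · exact key _ _ _ o₁ o₃ p₂ p₃ n₁
    · exact key _ _ _ o₂ o₃ p₂ p₁ n₃
  · exact key _ _ _ o₂ o₁ p₃ p₁ n₂

end Tree

/-! ### The running time on a tree -/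

section TreeCost

variable {n : ℕ} {I : Input n}

/-- The points with indices in `l`. -/
noncomputable def points (I : Input n) (l : List (Fin n)) : Finset Point := (l.map I).toFinset

theorem mem_points {l : List (Fin n)} {p : Point} : p ∈ points I l ↔ ∃ i ∈ l, I i = p := by
  simp [points]

theorem card_points (hI : Function.Injective I) {l : List (Fin n)} (hl : l.Nodup) :
    (points I l).card = l.length := by
  rw [points, List.toFinset_card_of_nodup (hl.map hI), List.length_map]

theorem filter_points (l : List (Fin n)) (U : Point → Prop) [DecidablePred U] :
    (points I l).filter U = points I (l.filter fun i => decide (U (I i))) := by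
  ext p
  simp only [Finset.mem_filter, mem_points, List.mem_filter, decide_eq_true_eq]
  constructor
  · rintro ⟨⟨i, hi, rfl⟩, h⟩
    exact ⟨i, ⟨hi, h⟩, rfl⟩
  · rintro ⟨i, ⟨hi, h⟩, rfl⟩
    exact ⟨⟨i, hi, rfl⟩, h⟩

/-- Only mixed nodes branch. The linear terms of the two children total at most 2040(len + 2) ≤ 6120
len, which is charged to their nonempty mixed parent. The list stays in input order throughout,
which is what lets `hsort` apply to each sublist. -/
theorem cost_paretoRec_le {κ : Type*} (c : Point → κ) (hI : Function.Injective I)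
    (hP : DistinctCoords (Set.range I))
    (hsort : ∀ l : List (Fin n), l.Pairwise (· < ·) → ¬ Mixed c (points I l) →
      (trySorted l).value (CoordTest.eval I) = true)
    (fuel : ℕ) (l : List (Fin n)) (hl : l.Pairwise (· < ·)) :
    (paretoRec fuel l).cost (CoordTest.eval I) ≤
      2040 * (l.length + 1) + 6120 * mixedSize c fuel (points I l) := by
  induction fuel generalizing l with
  | zero =>
    simp [paretoRec]
    omega
  | succ fuel ih =>
    rcases hs : (trySorted l).value (CoordTest.eval I) with _ | _
    swap
    · have := (paretoRec_succ_of_sorted fuel l hs).2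
      omega
    have hmix : Mixed c (points I l) := by
      by_contra h
      simp [hsort l hl h] at hs
    have hnd : l.Nodup := hl.imp fun h => h.ne
    have hx := (injective_coords hP hI fun i => Set.mem_range_self i).1
    have hPl : DistinctCoords (points I l : Set Point) := by
      refine hP.mono fun p hp => ?_
      obtain ⟨i, -, rfl⟩ := mem_points.1 (Finset.mem_coe.1 hp)
      exact Set.mem_range_self i
    obtain ⟨m, hm, q, hq, hr, hmq, hmax, h⟩ := paretoRec_succ hx l hnd hs
    have hrep : IsRep (points I l) (I q) := by
      refine ⟨I m, mem_points.2 ⟨m, hm, rfl⟩, ?_, mem_points.2 ⟨q, hq, rfl⟩, hmq, ?_⟩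
      · rw [filter_points, card_points hI (hnd.filter _), card_points hI hnd, ← hr,
          List.countP_eq_length_filter]
      · intro p hp hmp
        obtain ⟨i, hi, rfl⟩ := mem_points.1 hp
        exact hmax i hi hmp
    obtain ⟨-, hcost⟩ := h fuel _ _ rfl rfl
    have e₁ : child false (points I l) =
        points I (l.filter fun i => decide ((I q).2 < (I i).2)) := by
      rw [← filter_points l fun p => (I q).2 < p.2]
      ext p
      simp [mem_child_iff hPl hrep]
    have e₂ : child true (points I l) =
        points I (l.filter fun i => decide ((I q).1 < (I i).1)) := by
      rw [← filter_points l fun p => (I q).1 < p.1]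
      ext p
      simp [mem_child_iff hPl hrep]
    have c₁ := card_child_le hPl false
    have c₂ := card_child_le hPl true
    rw [e₁, card_points hI (hnd.filter _), card_points hI hnd] at c₁
    rw [e₂, card_points hI (hnd.filter _), card_points hI hnd] at c₂
    have i₁ := ih (l.filter fun i => decide ((I q).2 < (I i).2)) (hl.filter _)
    have i₂ := ih (l.filter fun i => decide ((I q).1 < (I i).1)) (hl.filter _)
    have hpos := List.length_pos_of_mem hm
    rw [mixedSize, if_pos hmix, e₁, e₂, card_points hI hnd]
    omega

end TreeCost

/-! ### Counting the outputs of a program -/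

namespace Prog

variable {T : Type} {n : ℕ} {α ι : Type}

-- A program is a binary decision tree whose writes are fixed by the answers, so cost at most t
-- leaves at most 2^t reachable outputs.
open scoped Classical in
theorem card_image_write_le (A : Prog T n α) (eval : ι → T → Bool) (s : Finset ι) (t : ℕ)
    (h : ∀ I ∈ s, A.cost (eval I) ≤ t) (o : Output n) :
    (s.image fun I => A.write (eval I) o).card ≤ 2 ^ t := by
  rcases s.eq_empty_or_nonempty with rfl | ⟨I₀, hI₀⟩
  · simp
  induction A generalizing s t o I₀ with
  | ret a =>
    have : (s.image fun I => (ret a : Prog T n α).write (eval I) o) ⊆ {o} := by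
      intro o' ho'
      obtain ⟨I, -, rfl⟩ := Finset.mem_image.1 ho'
      simp [write]
    exact (Finset.card_le_card this).trans (by simpa using Nat.one_le_two_pow)
  | test q k ih =>
    cases t with
    | zero => simpa [cost] using h I₀ hI₀
    | succ t =>
      have key : ∀ b, ((s.filter fun I => eval I q = b).image
          fun I => (k b).write (eval I) o).card ≤ 2 ^ t := by
        intro b
        rcases (s.filter fun I => eval I q = b).eq_empty_or_nonempty with he | ⟨I₁, hI₁⟩
        · simp [he]
        · refine ih b _ t (fun I hI => ?_) o I₁ hI₁
          obtain ⟨hI, hb⟩ := Finset.mem_filter.1 hI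
          have := h I hI
          simp only [cost, hb] at this
          omega
      have hsub : (s.image fun I => (test q k).write (eval I) o) ⊆
          ((s.filter fun I => eval I q = true).image fun I => (k true).write (eval I) o) ∪
          ((s.filter fun I => eval I q = false).image fun I => (k false).write (eval I) o) := by
        intro o' ho'
        obtain ⟨I, hI, rfl⟩ := Finset.mem_image.1 ho'
        rw [Finset.mem_union, Finset.mem_image, Finset.mem_image]
        rcases hb : eval I q with _ | _
        · exact Or.inr ⟨I, Finset.mem_filter.2 ⟨hI, hb⟩, by simp [write, hb]⟩
        · exact Or.inl ⟨I, Finset.mem_filter.2 ⟨hI, hb⟩, by simp [write, hb]⟩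
      have := (Finset.card_le_card hsub).trans (Finset.card_union_le _ _)
      have := key true
      have := key false
      rw [pow_succ]
      omega
  | step k ih =>
    exact ih s t (fun I hI => (Nat.le_succ _).trans (h I hI)) o I₀ hI₀
  | pushFront i k ih =>
    exact ih s t (fun I hI => (Nat.le_succ _).trans (h I hI)) _ I₀ hI₀
  | setWitness i j k ih =>
    exact ih s t (fun I hI => (Nat.le_succ _).trans (h I hI)) _ I₀ hI₀

theorem length_front_add_card_witness_le (A : Prog T n α) (ans : T → Bool) (o : Output n) :
    (A.write ans o).front.length +
        (Finset.univ.filter fun i => (A.write ans o).witness i ≠ none).card ≤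
      o.front.length + (Finset.univ.filter fun i => o.witness i ≠ none).card + A.cost ans := by
  induction A generalizing o with
  | ret a => exact le_rfl
  | test t k ih => exact (ih _ o).trans (Nat.le_succ _)
  | step k ih => exact (ih o).trans (Nat.le_succ _)
  | pushFront i k ih =>
    refine (ih _).trans ?_
    simp only [List.length_append, List.length_singleton, cost]
    omega
  | setWitness i j k ih =>
    refine (ih _).trans ?_
    have hsub : (Finset.univ.filter fun l => Function.update o.witness i (some j) l ≠ none) ⊆
        insert i (Finset.univ.filter fun l => o.witness l ≠ none) := by
      intro l hl
      by_cases hli : l = i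
      · simp [hli]
      · simpa [hli] using hl
    have := (Finset.card_le_card hsub).trans (Finset.card_insert_le _ _)
    simp only [cost]
    omega

/-- Every index appears in the front list or has a witness, and each elementary operation accounts
for at most one of them. -/
theorem le_cost_of_isSolution (A : Prog T n α) (ans : T → Bool) (I : Input n)
    (h : IsSolution I (A.output ans)) (hI : Function.Injective I) : n ≤ A.cost ans := by
  have h₁ := length_front_add_card_witness_le A ans (Output.blank n)
  have h₂ : (Finset.univ : Finset (Fin n)) ⊆ (A.write ans (Output.blank n)).front.toFinset ∪
      Finset.univ.filter fun i => (A.write ans (Output.blank n)).witness i ≠ none := by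
    intro i _
    rw [Finset.mem_union, List.mem_toFinset, Finset.mem_filter]
    by_cases hi : I i ∈ paretoFront (Set.range I)
    · obtain ⟨j, hj, hji⟩ := List.mem_map.1 ((h.1.1 _).2 hi)
      exact Or.inl (hI hji ▸ hj)
    · obtain ⟨j, hj, -⟩ := (h.2 i).2 hi
      exact Or.inr ⟨Finset.mem_univ i, fun h' => Option.some_ne_none j (hj.symm.trans h')⟩
  have h₃ := (Finset.card_le_card h₂).trans (Finset.card_union_le _ _)
  have h₄ := List.toFinset_card_le (A.write ans (Output.blank n)).front
  have h₅ : (Finset.univ.filter fun i => (Output.blank n).witness i ≠ none).card = 0 := by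
    simp [Output.blank]
  have h₆ : (Output.blank n).front.length = 0 := rfl
  rw [Finset.card_univ, Fintype.card_fin] at h₃
  omega

end Prog

/-! ### Inputs with the same output -/

section SameOutput

variable {n : ℕ} {P : Set Point}

theorem map_front_eq {I I' : Input n} (hI : Set.range I = P) (hI' : Set.range I' = P)
    {F : List (Fin n)} (h : IsFrontList I F) (h' : IsFrontList I' F) : F.map I = F.map I' := by
  have s₁ : (F.map I).Pairwise fun p q => p.1 < q.1 := List.pairwise_map.2 h.2
  have s₂ : (F.map I').Pairwise fun p q => p.1 < q.1 := List.pairwise_map.2 h'.2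
  have n₁ : (F.map I).Nodup := s₁.imp fun h h' => by simp [h'] at h
  have n₂ : (F.map I').Nodup := s₂.imp fun h h' => by simp [h'] at h
  have hp : (F.map I).Perm (F.map I') := (List.perm_ext_iff_of_nodup n₁ n₂).2 fun p => by
    rw [h.1, h'.1, hI, hI']
  exact hp.eq_of_pairwise (fun a b _ _ hab hba => absurd hab (lt_asymm hba)) s₁ s₂

/-- The witness pointers depend only on `o`, so following them from `i` ends at the same front index
`k` for every input in `N`. By `map_front_eq` a front index stores the same point in all these
inputs. -/
theorem exists_common_dominator {o : Output n} {N : Set (Input n)}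
    (hinj : ∀ I ∈ N, Function.Injective I) (hrange : ∀ I ∈ N, Set.range I = P)
    (hsol : ∀ I ∈ N, IsSolution I o) (hN : N.Nonempty) (i : Fin n) :
    ∃ f ∈ P, ∀ I ∈ N, (I i).1 ≤ f.1 ∧ (I i).2 ≤ f.2 := by
  obtain ⟨I₀, hI₀⟩ := hN
  -- A single input suffices to show that the witness pointers terminate; the end point then serves
  -- every input in `N`.
  have hwf : WellFounded fun j i : Fin n => I₀ i < I₀ j := by
    have : IsTrans (Fin n) fun j i => I₀ i < I₀ j := ⟨fun _ _ _ h h' => lt_trans h' h⟩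
    have : Std.Irrefl fun j i : Fin n => I₀ i < I₀ j := ⟨fun _ => lt_irrefl _⟩
    exact Finite.wellFounded_of_trans_of_irrefl _
  have hroot : ∀ i, ∃ k, o.witness k = none ∧ ∀ I ∈ N, I i ≤ I k := by
    intro i
    induction i using hwf.induction with
    | _ i ih =>
      rcases hw : o.witness i with _ | j
      · exact ⟨i, hw, fun I _ => le_rfl⟩
      · have hdom : ∀ I ∈ N, Dominates (I j) (I i) := by
          intro I hI
          by_cases hf : I i ∈ paretoFront (Set.range I)
          · have := ((hsol I hI).2 i).1 hf
            simp [hw] at this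
          · obtain ⟨j', hj', hd⟩ := ((hsol I hI).2 i).2 hf
            rw [hw, Option.some_inj] at hj'
            rwa [hj']
        have hle : ∀ I ∈ N, I i ≤ I j := fun I hI => (hdom I hI).2
        obtain ⟨k, hk, hk'⟩ := ih j (lt_of_le_of_ne (hle I₀ hI₀) (hdom I₀ hI₀).1.symm)
        exact ⟨k, hk, fun I hI => (hle I hI).trans (hk' I hI)⟩
  obtain ⟨k, hk, hle⟩ := hroot i
  refine ⟨I₀ k, hrange I₀ hI₀ ▸ Set.mem_range_self k, fun I hI => ?_⟩
  have hfront : I₀ k ∈ paretoFront (Set.range I₀) := by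
    by_contra hf
    obtain ⟨j, hj, -⟩ := ((hsol I₀ hI₀).2 k).2 hf
    simp [hk] at hj
  obtain ⟨k', hk', hkk'⟩ := List.mem_map.1 (((hsol I₀ hI₀).1.1 _).2 hfront)
  rw [hinj I₀ hI₀ hkk'] at hk'
  have hmap := map_front_eq (hrange I hI) (hrange I₀ hI₀) (hsol I hI).1 (hsol I₀ hI₀).1
  rw [← List.map_inj_left.1 hmap k hk']
  exact hle I hI

end SameOutput

/-! ### Inputs that are sorted within every class -/

section SortedInputs

variable {κ : Type*} (c : Point → κ) {n : ℕ} {P : Finset Point}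

/-- Within every class, the points appear by increasing x-coordinate. -/
def SortedInClasses (I : Input n) : Prop :=
  ∀ i j, i < j → c (I i) = c (I j) → (I i).1 < (I j).1

theorem prod_input {M : Type*} [CommMonoid M] {I : Input n} (hI : Function.Injective I)
    (hP : Set.range I = P) (g : Point → M) : ∏ i, g (I i) = ∏ p ∈ P, g p := by
  classical
  have : P = Finset.univ.image I := by
    apply Finset.coe_injective
    simp [hP]
  rw [this, Finset.prod_image hI.injOn]

/-- At the first position where the inputs differ, the point of one occurs later in the other,
within the same class; so the other has the smaller x there. By symmetry this is absurd. -/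
theorem eq_of_comp_eq {I I' : Input n} (hI : Function.Injective I) (hP : Set.range I = P)
    (hI' : Function.Injective I') (hP' : Set.range I' = P) (hs : SortedInClasses c I)
    (hs' : SortedInClasses c I') (h : ∀ i, c (I i) = c (I' i)) : I = I' := by
  have key : ∀ (J J' : Input n), Function.Injective J → Set.range J = P →
      Set.range J' = P → SortedInClasses c J' → (∀ i, c (J i) = c (J' i)) →
      ∀ i, (∀ j < i, J j = J' j) → J i ≠ J' i → (J' i).1 < (J i).1 := by
    intro J J' hJ hJP hJP' hs' h i ih hne
    obtain ⟨j, hj⟩ : J i ∈ Set.range J' := by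
      rw [hJP', ← hJP]
      exact Set.mem_range_self i
    rcases lt_trichotomy j i with hji | rfl | hij
    · rw [← ih j hji] at hj
      exact absurd (hJ hj) hji.ne
    · exact absurd hj.symm hne
    · rw [← hj]
      exact hs' i j hij (by rw [hj, h i])
  funext i
  induction i using WellFoundedLT.induction with
  | _ i ih =>
    by_contra hne
    exact lt_asymm (key I I' hI hP hP' hs' h i ih hne)
      (key I' I hI' hP' hP hs (fun i => (h i).symm) i (fun j hj => (ih j hj).symm) (Ne.symm hne))

/-- Rearrangement: among the class-preserving permutations take one maximising the sum of position
times x-coordinate. Swapping an inverted pair of one class would increase it. -/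
theorem exists_sortedInClasses (hP : DistinctCoords (P : Set Point)) {I : Input n}
    (hI : Function.Injective I) (hIP : Set.range I = P) :
    ∃ J : Input n, Function.Injective J ∧ Set.range J = P ∧ SortedInClasses c J ∧
      ∀ i, c (J i) = c (I i) := by
  classical
  let s : Finset (Equiv.Perm (Fin n)) := Finset.univ.filter fun σ => ∀ i, c (I (σ i)) = c (I i)
  have hs : s.Nonempty := ⟨1, by simp [s]⟩
  obtain ⟨σ, hσ, hmax⟩ := s.exists_max_image (fun σ => ∑ i : Fin n, ((i : ℕ) : ℝ) * (I (σ i)).1) hs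
  have hσc : ∀ i, c (I (σ i)) = c (I i) := (Finset.mem_filter.1 hσ).2
  refine ⟨I ∘ σ, hI.comp σ.injective, by rw [σ.surjective.range_comp, hIP], ?_, hσc⟩
  intro i j hij hc
  by_contra hlt
  have hne : I (σ i) ≠ I (σ j) := fun h => hij.ne (σ.injective (hI h))
  have hlt' : (I (σ j)).1 < (I (σ i)).1 := by
    refine lt_of_le_of_ne (not_lt.1 hlt) fun h => (hP _ ?_ _ ?_ hne).1 h.symm
    · rw [← hIP]; exact Set.mem_range_self _
    · rw [← hIP]; exact Set.mem_range_self _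
  have hτ : σ * Equiv.swap i j ∈ s := by
    refine Finset.mem_filter.2 ⟨Finset.mem_univ _, fun k => ?_⟩
    rw [Equiv.Perm.mul_apply]
    by_cases hki : k = i
    · subst hki
      rw [Equiv.swap_apply_left, ← hσc k]
      exact hc.symm
    · by_cases hkj : k = j
      · subst hkj
        rw [Equiv.swap_apply_right, ← hσc k]
        exact hc
      · rw [Equiv.swap_apply_of_ne_of_ne hki hkj, hσc]
  have hle := hmax _ hτ
  rw [← sub_nonpos, ← Finset.sum_sub_distrib] at hle
  rw [Finset.sum_eq_add i j hij.ne] at hle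
  · simp only [Equiv.Perm.mul_apply, Equiv.swap_apply_left, Equiv.swap_apply_right] at hle
    have hij' : ((i : ℕ) : ℝ) < ((j : ℕ) : ℝ) := by exact_mod_cast hij
    nlinarith [mul_pos (sub_pos.2 hij') (sub_pos.2 hlt')]
  · intro k _ hk
    rw [Equiv.Perm.mul_apply, Equiv.swap_apply_of_ne_of_ne hk.1 hk.2, sub_self]
  · simp
  · simp

open scoped Classical in
/-- The inputs that store `P` and are sorted within every class. -/
noncomputable def sortedInputs (n : ℕ) (P : Finset Point) : Finset (Input n) :=
  (Fintype.piFinset fun _ => P).filter fun I =>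
    Function.Injective I ∧ Set.range I = P ∧ SortedInClasses c I

theorem mem_sortedInputs {I : Input n} : I ∈ sortedInputs c n P ↔
    Function.Injective I ∧ Set.range I = P ∧ SortedInClasses c I := by
  classical
  refine Finset.mem_filter.trans ⟨And.right, fun h => ⟨Fintype.mem_piFinset.2 fun i => ?_, h⟩⟩
  rw [← Finset.mem_coe, ← h.2.1]
  exact Set.mem_range_self i

theorem exists_input (P : Finset Point) :
    ∃ I : Input P.card, Function.Injective I ∧ Set.range I = P := by
  let e := P.equivFin.symm
  refine ⟨fun i => e i, Subtype.val_injective.comp e.injective, ?_⟩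
  rw [show (fun i => (e i : Point)) = Subtype.val ∘ e from rfl, e.surjective.range_comp]
  simp

/-- The number of points of `P` that have the colour `a`. -/
noncomputable def colourCard {κ : Type*} (c : Point → κ) (P : Finset Point) (a : κ) : ℕ :=
  open scoped Classical in (P.filter fun p => c p = a).card

theorem colourCard_eq [DecidableEq κ] (P : Finset Point) (a : κ) :
    colourCard c P a = (P.filter fun p => c p = a).card := by
  unfold colourCard
  congr

theorem colourCard_pos {p : Point} (hp : p ∈ P) : 0 < colourCard c P (c p) := by
  classical
  exact Finset.card_pos.2 ⟨p, Finset.mem_filter.2 ⟨hp, rfl⟩⟩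

/-- Send each ordering of the points to an input sorted within classes with the same class at every
position. An ordering over a given sorted input picks, at each position, a point of the prescribed
class, which bounds the fibres by the product of the class sizes. -/
theorem factorial_le_card_sortedInputs (hP : DistinctCoords (P : Set Point)) :
    P.card.factorial ≤
      (∏ p ∈ P, colourCard c P (c p)) * (sortedInputs c P.card P).card := by
  classical
  obtain ⟨I₀, hI₀, hr₀⟩ := exists_input P
  have hσ : ∀ σ : Equiv.Perm (Fin P.card), ∃ J : Input P.card, Function.Injective J ∧
      Set.range J = P ∧ SortedInClasses c J ∧ ∀ i, c (J i) = c (I₀ (σ i)) := fun σ =>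
    exists_sortedInClasses c hP (hI₀.comp σ.injective) ((σ.surjective.range_comp I₀).trans hr₀)
  choose J hJ hJr hJs hJc using hσ
  have hcard := Finset.card_le_mul_card_image_of_maps_to (s := Finset.univ)
    (f := J) (t := sortedInputs c P.card P)
    (fun σ _ => (mem_sortedInputs c).2 ⟨hJ σ, hJr σ, hJs σ⟩)
    (∏ p ∈ P, colourCard c P (c p)) ?_
  · simpa [Fintype.card_perm] using hcard
  · intro K hK
    obtain ⟨hK, hKr, -⟩ := (mem_sortedInputs c).1 hK
    rw [← prod_input hK hKr fun p => colourCard c P (c p)]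
    have hpi : (Fintype.piFinset fun i => P.filter fun p => c p = c (K i)).card =
        ∏ i, colourCard c P (c (K i)) := by
      rw [Fintype.card_piFinset]
      rfl
    rw [← hpi]
    refine Finset.card_le_card_of_injOn (fun σ i => I₀ (σ i)) (fun σ hσ => ?_) ?_
    · rw [Finset.mem_coe, Finset.mem_filter] at hσ
      rw [Finset.mem_coe, Fintype.mem_piFinset]
      intro i
      refine Finset.mem_filter.2 ⟨?_, ?_⟩
      · rw [← Finset.mem_coe, ← hr₀]
        exact Set.mem_range_self _
      · rw [← hσ.2, hJc]
    · intro σ _ τ _ h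
      exact Equiv.ext fun i => hI₀ (congrFun h i)

end SortedInputs

/-! ### The weights of the colours -/

theorem sum_range_pow_le (r : ℝ) (h₀ : 0 ≤ r) (h₁ : r < 1) (N : ℕ) :
    ∑ d ∈ Finset.range N, r ^ d ≤ (1 - r)⁻¹ := by
  rw [← tsum_geometric_of_lt_one h₀ h₁]
  exact (summable_geometric_of_lt_one h₀ h₁).sum_le_tsum _ fun d _ => pow_nonneg h₀ d

/-- A crude replacement for the inequality of arithmetic and geometric means, from x ≤ exp x. -/
theorem prod_le_exp_sum {ι : Type*} (s : Finset ι) (x : ι → ℝ) (h : ∀ i ∈ s, 0 ≤ x i) :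
    ∏ i ∈ s, x i ≤ Real.exp (∑ i ∈ s, x i) := by
  rw [Real.exp_sum]
  exact Finset.prod_le_prod h fun i _ => (le_add_of_nonneg_right zero_le_one).trans (Real.add_one_le_exp _)

section Weights

variable {κ : Type*} (c : Point → κ) (P : Finset Point) (k : ℕ)

/-- The colour of a point: its class and its address. -/
noncomputable def colour (p : Point) : κ × List Bool := (c p, address c k P p)

/-- The weight of a colour. -/
noncomputable def weight (x : κ × List Bool) : ℝ :=
  -- The base must be below 2, so that weights along a branch of halving nodes form a convergent
  -- geometric series, and above 4/3, so that its product with the factor 3/4 used in `sum_ratio_le`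
  -- exceeds 1.
  (3 / 2) ^ x.2.length * colourCard (colour c P k) P x / P.card

theorem weight_nonneg (x : κ × List Bool) : 0 ≤ weight c P k x := by
  unfold weight
  positivity

variable {c P k}

/-- The points that lie in a common node with `f`, weighted by depth. -/
theorem sum_pow_length_le (hP : DistinctCoords (P : Set Point)) (f : Point)
    (Q : Finset Point) (hQ : Q ⊆ P) (hf : ∀ p ∈ Q, f ∈ node P (address c k P p)) :
    ∑ p ∈ Q, (3 / 2 : ℝ) ^ (address c k P p).length ≤ 4 * P.card := by
  set δ : Point → ℕ := fun p => (address c k P p).length with hδ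
  set N := Q.sup δ + 1
  have hmaps : ∀ p ∈ Q, δ p ∈ Finset.range N := fun p hp =>
    Finset.mem_range.2 (Nat.lt_succ_of_le (Finset.le_sup hp))
  rw [← Finset.sum_fiberwise_of_maps_to hmaps]
  -- Only one node of depth d contains `f`, and it has at most n/2^d points; so level d contributes
  -- at most n(3/4)^d.
  have hfib : ∀ d ∈ Finset.range N, ∑ p ∈ Q with δ p = d, (3 / 2 : ℝ) ^ (address c k P p).length ≤
      P.card * (3 / 4 : ℝ) ^ d := by
    intro d _
    have hconst : ∑ p ∈ Q with δ p = d, (3 / 2 : ℝ) ^ (address c k P p).length =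
        (Q.filter fun p => δ p = d).card * (3 / 2 : ℝ) ^ d := by
      rw [← nsmul_eq_mul, ← Finset.sum_const]
      exact Finset.sum_congr rfl fun p hp => by rw [← (Finset.mem_filter.1 hp).2]
    rw [hconst]
    rcases (Q.filter fun p => δ p = d).eq_empty_or_nonempty with he | ⟨p₀, hp₀⟩
    · rw [he]
      simp only [Finset.card_empty, Nat.cast_zero, zero_mul]
      positivity
    obtain ⟨hp₀, hd₀⟩ := Finset.mem_filter.1 hp₀
    have hsub : (Q.filter fun p => δ p = d) ⊆ node P (address c k P p₀) := by
      intro p hp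
      obtain ⟨hp, hd⟩ := Finset.mem_filter.1 hp
      rw [eq_of_mem_node hP (hd₀.trans hd.symm) (hf p₀ hp₀) (hf p hp)]
      exact mem_node_address c k P p (hQ hp)
    have h₁ := Finset.card_le_card hsub
    have h₂ := card_node_mul_le hP (address c k P p₀)
    rw [show (address c k P p₀).length = d from hd₀] at h₂
    have h₃ : ((Q.filter fun p => δ p = d).card : ℝ) * 2 ^ d ≤ P.card := by
      exact_mod_cast (Nat.mul_le_mul_right _ h₁).trans h₂
    calc ((Q.filter fun p => δ p = d).card : ℝ) * (3 / 2) ^ d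
        = ((Q.filter fun p => δ p = d).card : ℝ) * 2 ^ d * (3 / 4) ^ d := by
          rw [mul_assoc, ← mul_pow]
          norm_num
      _ ≤ P.card * (3 / 4 : ℝ) ^ d := by gcongr
  refine (Finset.sum_le_sum hfib).trans ?_
  rw [← Finset.mul_sum]
  have := sum_range_pow_le (3 / 4) (by norm_num) (by norm_num) N
  have hn : (0 : ℝ) ≤ P.card := Nat.cast_nonneg _
  norm_num at this
  nlinarith

-- Whether a point lies in `Q` depends only on its address, so a colour meeting `Q` is contained in
-- it and its weight can be spread evenly over its points.
open scoped Classical in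
theorem sum_weight_le (hP : DistinctCoords (P : Set Point)) (f : Point) :
    ∑ x ∈ (P.filter fun p => f ∈ node P (address c k P p)).image (colour c P k),
      weight c P k x ≤ 4 := by
  set Q := P.filter fun p => f ∈ node P (address c k P p) with hQ
  have hfib : ∀ x ∈ Q.image (colour c P k), weight c P k x =
      ∑ p ∈ Q with colour c P k p = x, (3 / 2 : ℝ) ^ (address c k P p).length / P.card := by
    intro x hx
    obtain ⟨p₀, hp₀, rfl⟩ := Finset.mem_image.1 hx
    have hset : (Q.filter fun p => colour c P k p = colour c P k p₀) =
        P.filter fun p => colour c P k p = colour c P k p₀ := by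
      ext p
      simp only [hQ, Finset.mem_filter]
      refine ⟨fun h => ⟨h.1.1, h.2⟩, fun h => ⟨⟨h.1, ?_⟩, h.2⟩⟩
      have h' : address c k P p = address c k P p₀ := congrArg Prod.snd h.2
      rw [h']
      exact (Finset.mem_filter.1 hp₀).2
    rw [hset, weight, colourCard_eq, mul_comm, mul_div_assoc, ← nsmul_eq_mul, ← Finset.sum_const]
    refine Finset.sum_congr rfl fun p hp => ?_
    have h' : colour c P k p = colour c P k p₀ := (Finset.mem_filter.1 hp).2
    rw [← h']
    rfl
  rw [Finset.sum_congr rfl hfib,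
    Finset.sum_fiberwise_of_maps_to fun p hp => Finset.mem_image_of_mem _ hp, ← Finset.sum_div]
  refine div_le_of_le_mul₀ (Nat.cast_nonneg _) (by norm_num) ?_
  exact sum_pow_length_le hP f Q (Finset.filter_subset _ _) fun p hp => (Finset.mem_filter.1 hp).2

/-- The inputs with a common output have bounded total weight. -/
theorem card_mul_prod_weight_le (hP : DistinctCoords (P : Set Point)) {n : ℕ}
    (N : Finset (Input n)) (hN : N ⊆ sortedInputs c n P) (o : Output n)
    (ho : ∀ I ∈ N, IsSolution I o) :
    N.card * ∏ p ∈ P, weight c P k (colour c P k p) ≤ 4 ^ n := by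
  classical
  rcases N.eq_empty_or_nonempty with rfl | hne
  · simp
  have hmem : ∀ I ∈ N, _ := fun I hI => (mem_sortedInputs c).1 (hN hI)
  have hdom := exists_common_dominator (N := (N : Set (Input n))) (fun I hI => (hmem I hI).1)
    (fun I hI => (hmem I hI).2.1) ho hne
  choose f hfP hf using hdom
  -- The colours possible at position i: the node of the point stored there is closed upwards, hence
  -- contains `f i`.
  set C : Fin n → Finset (κ × List Bool) := fun i =>
    (P.filter fun p => f i ∈ node P (address c k P p)).image (colour c P k) with hC
  have hmaps : N.image (fun I i => colour c P k (I i)) ⊆ Fintype.piFinset C := by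
    intro χ hχ
    obtain ⟨I, hI, rfl⟩ := Finset.mem_image.1 hχ
    rw [Fintype.mem_piFinset]
    intro i
    have hIi : I i ∈ P := by
      rw [← Finset.mem_coe, ← (hmem I hI).2.1]
      exact Set.mem_range_self i
    refine Finset.mem_image_of_mem _ (Finset.mem_filter.2 ⟨hIi, ?_⟩)
    exact node_upward (mem_node_address c k P _ hIi) (hfP i) (hf i I hI).1 (hf i I hI).2
  -- Distinct inputs have distinct colourings, so the sum over inputs is at most the sum over all
  -- choices of one colour from each `C i`, which factorises.
  have hinj : Set.InjOn (fun I i => colour c P k (I i)) (N : Set (Input n)) := by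
    intro I hI J hJ h
    obtain ⟨i₁, r₁, s₁⟩ := hmem I hI
    obtain ⟨i₂, r₂, s₂⟩ := hmem J hJ
    exact eq_of_comp_eq c i₁ r₁ i₂ r₂ s₁ s₂ fun i => congrArg Prod.fst (congrFun h i)
  calc N.card * ∏ p ∈ P, weight c P k (colour c P k p)
      = ∑ I ∈ N, ∏ i, weight c P k (colour c P k (I i)) := by
        rw [← nsmul_eq_mul, ← Finset.sum_const]
        exact Finset.sum_congr rfl fun I hI =>
          (prod_input (hmem I hI).1 (hmem I hI).2.1 fun p => weight c P k (colour c P k p)).symm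
    _ = ∑ χ ∈ N.image fun I i => colour c P k (I i), ∏ i, weight c P k (χ i) := by
        rw [Finset.sum_image hinj]
    _ ≤ ∑ χ ∈ Fintype.piFinset C, ∏ i, weight c P k (χ i) :=
        Finset.sum_le_sum_of_subset_of_nonneg hmaps fun χ _ _ =>
          Finset.prod_nonneg fun i _ => weight_nonneg c P k _
    _ = ∏ i, ∑ x ∈ C i, weight c P k x := (Finset.prod_univ_sum C fun _ x => weight c P k x).symm
    _ ≤ ∏ _i : Fin n, (4 : ℝ) :=
        Finset.prod_le_prod (fun i _ => Finset.sum_nonneg fun x _ => weight_nonneg c P k x)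
          fun i _ => sum_weight_le hP (f i)
    _ = 4 ^ n := by simp

open scoped Classical in
/-- The addresses of the points of one class, weighted by depth. -/
theorem sum_addresses_le (hP : DistinctCoords (P : Set Point)) (hc : BoxConvex c P) (a : κ) :
    ∑ w ∈ (P.filter fun p => c p = a).image (address c k P), (3 / 4 : ℝ) ^ w.length ≤ 8 := by
  set A := (P.filter fun p => c p = a).image (address c k P) with hA
  set N := A.sup List.length + 1
  have hmaps : ∀ w ∈ A, w.length ∈ Finset.range N := fun w hw =>
    Finset.mem_range.2 (Nat.lt_succ_of_le (Finset.le_sup hw))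
  rw [← Finset.sum_fiberwise_of_maps_to hmaps]
  have hfib : ∀ d ∈ Finset.range N,
      ∑ w ∈ A with w.length = d, (3 / 4 : ℝ) ^ w.length ≤ 2 * (3 / 4 : ℝ) ^ d := by
    intro d _
    have hconst : ∑ w ∈ A with w.length = d, (3 / 4 : ℝ) ^ w.length =
        (A.filter fun w => w.length = d).card * (3 / 4 : ℝ) ^ d := by
      rw [← nsmul_eq_mul, ← Finset.sum_const]
      exact Finset.sum_congr rfl fun w hw => by rw [(Finset.mem_filter.1 hw).2]
    rw [hconst]
    have : (A.filter fun w => w.length = d).card ≤ 2 := by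
      convert card_addresses_le_two c hP hc k d a
    have : ((A.filter fun w => w.length = d).card : ℝ) ≤ 2 := by exact_mod_cast this
    gcongr
  refine (Finset.sum_le_sum hfib).trans ?_
  rw [← Finset.mul_sum]
  have := sum_range_pow_le (3 / 4) (by norm_num) (by norm_num) N
  norm_num at this
  linarith

/-- The relative sizes of the classes and of their colours. -/
theorem sum_ratio_le (hP : DistinctCoords (P : Set Point)) (hc : BoxConvex c P) :
    ∑ p ∈ P, (colourCard c P (c p) : ℝ) * (3 / 4) ^ (address c k P p).length /
      colourCard (colour c P k) P (colour c P k p) ≤ 8 * P.card := by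
  classical
  have hclass : ∀ a ∈ P.image c,
      ∑ p ∈ P with c p = a, (colourCard c P (c p) : ℝ) * (3 / 4) ^ (address c k P p).length /
        colourCard (colour c P k) P (colour c P k p) ≤ 8 * colourCard c P a := by
    intro a _
    rw [← Finset.sum_fiberwise_of_maps_to (g := address c k P)
      (t := (P.filter fun p => c p = a).image (address c k P))
      fun p hp => Finset.mem_image_of_mem _ hp]
    -- The points of one colour share the same summand, so its denominator cancels against their
    -- number.
    have hcol : ∀ w ∈ (P.filter fun p => c p = a).image (address c k P),
        ∑ p ∈ P.filter (fun p => c p = a) with address c k P p = w,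
          (colourCard c P (c p) : ℝ) * (3 / 4) ^ (address c k P p).length /
          colourCard (colour c P k) P (colour c P k p) =
        colourCard c P a * (3 / 4 : ℝ) ^ w.length := by
      intro w hw
      obtain ⟨p₀, hp, rfl⟩ := Finset.mem_image.1 hw
      obtain ⟨hp₀, rfl⟩ := Finset.mem_filter.1 hp
      have hset : (P.filter fun p => c p = c p₀).filter
          (fun p => address c k P p = address c k P p₀) =
          P.filter fun p => colour c P k p = colour c P k p₀ := by
        ext p
        simp [colour, Prod.ext_iff, and_assoc]
      rw [hset]
      have hpos : (0 : ℝ) < colourCard (colour c P k) P (colour c P k p₀) := by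
        exact_mod_cast colourCard_pos (P := P) (colour c P k) hp₀
      have hconst : ∀ p ∈ P.filter fun p => colour c P k p = colour c P k p₀,
          (colourCard c P (c p) : ℝ) * (3 / 4) ^ (address c k P p).length /
            colourCard (colour c P k) P (colour c P k p) =
          (colourCard c P (c p₀) : ℝ) * (3 / 4) ^ (address c k P p₀).length /
            colourCard (colour c P k) P (colour c P k p₀) := by
        intro p hp
        have h := (Finset.mem_filter.1 hp).2
        have h₁ : c p = c p₀ := congrArg Prod.fst h
        have h₂ : address c k P p = address c k P p₀ := congrArg Prod.snd h
        rw [h, h₁, h₂]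
      rw [Finset.sum_congr rfl hconst, Finset.sum_const, nsmul_eq_mul,
        ← colourCard_eq (colour c P k) P, mul_div_cancel₀ _ hpos.ne']
    rw [Finset.sum_congr rfl hcol, ← Finset.mul_sum, mul_comm]
    exact mul_le_mul_of_nonneg_right (sum_addresses_le hP hc a) (Nat.cast_nonneg _)
  rw [← Finset.sum_fiberwise_of_maps_to (g := c) fun p hp => Finset.mem_image_of_mem c hp]
  refine (Finset.sum_le_sum hclass).trans ?_
  rw [← Finset.mul_sum]
  have h₁ : P.card = ∑ a ∈ P.image c, colourCard c P a :=
    Finset.card_eq_sum_card_fiberwise fun p hp => Finset.mem_image_of_mem c hp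
  have h₂ : (P.card : ℝ) = ∑ a ∈ P.image c, (colourCard c P a : ℝ) := by exact_mod_cast h₁
  rw [h₂]

/-- The lower bound: the total depth of the points is at most linear in the running time of any
program that is correct on the sorted inputs. -/
theorem sum_length_address_le (hP : DistinctCoords (P : Set Point)) (hc : BoxConvex c P)
    {n : ℕ} (hn : P.card = n) {T : Type} (eval : Input n → T → Bool) (B : Prog T n Unit) (t : ℕ)
    (hB : ∀ I ∈ sortedInputs c n P, IsSolution I (B.output (eval I)))
    (ht : ∀ I ∈ sortedInputs c n P, B.cost (eval I) ≤ t) :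
    ∑ p ∈ P, (address c k P p).length ≤ 9 * t + 99 * n := by
  classical
  set U := sortedInputs c n P with hU
  set W := ∏ p ∈ P, weight c P k (colour c P k p) with hW
  set M : ℝ := ∏ p ∈ P, (colourCard c P (c p) : ℝ) with hM
  set X := ∏ p ∈ P, ((colourCard c P (c p) : ℝ) * (3 / 4) ^ (address c k P p).length /
      colourCard (colour c P k) P (colour c P k p)) with hX
  set D := ∑ p ∈ P, (address c k P p).length with hD
  have hW0 : 0 ≤ W := Finset.prod_nonneg fun p _ => weight_nonneg c P k _
  have hM0 : 0 < M := Finset.prod_pos fun p hp => by exact_mod_cast colourCard_pos c hp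
  have hX0 : 0 ≤ X := Finset.prod_nonneg fun p _ => by positivity
  have hXle : X ≤ Real.exp (8 * n) :=
    (prod_le_exp_sum P _ fun p _ => by positivity).trans
      (Real.exp_le_exp.2 (hn ▸ sum_ratio_le hP hc))
  have hfact : (n.factorial : ℝ) ≤ M * U.card := by
    have := factorial_le_card_sortedInputs c hP
    rw [hn, ← hU] at this
    have h' : ((n.factorial : ℕ) : ℝ) ≤
        (((∏ p ∈ P, colourCard c P (c p)) * U.card : ℕ) : ℝ) := by exact_mod_cast this
    rwa [Nat.cast_mul, Nat.cast_prod] at h'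
  -- Group the sorted inputs by output: at most 2^t groups, each with count times `W` at most 4^n.
  have hUW : U.card * W ≤ 2 ^ t * 4 ^ n := by
    set f : Input n → Output n := fun I => B.output (eval I) with hf
    have h₁ : U.card = ∑ o ∈ U.image f, (U.filter fun I => f I = o).card :=
      Finset.card_eq_sum_card_fiberwise fun I hI => Finset.mem_image_of_mem f hI
    have h₂ : ((U.image f).card : ℝ) ≤ 2 ^ t := by
      exact_mod_cast Prog.card_image_write_le B eval U t ht (Output.blank n)
    calc (U.card : ℝ) * W = ∑ o ∈ U.image f, ((U.filter fun I => f I = o).card : ℝ) * W := by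
          rw [h₁, Nat.cast_sum, Finset.sum_mul]
      _ ≤ ∑ _o ∈ U.image f, (4 : ℝ) ^ n := by
          refine Finset.sum_le_sum fun o _ => ?_
          refine card_mul_prod_weight_le hP _ (Finset.filter_subset _ _) o fun I hI => ?_
          obtain ⟨hIU, hIo⟩ := Finset.mem_filter.1 hI
          exact hIo ▸ hB I hIU
      _ = (U.image f).card * 4 ^ n := by rw [Finset.sum_const, nsmul_eq_mul]
      _ ≤ 2 ^ t * 4 ^ n := by gcongr
  -- Pointwise, the colour sizes and the factor n cancel and (3/2)(3/4) = 9/8.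
  have hWX : W * X * n ^ n = (9 / 8) ^ D * M := by
    have h₁ : ∀ p ∈ P, weight c P k (colour c P k p) *
        ((colourCard c P (c p) : ℝ) * (3 / 4) ^ (address c k P p).length /
          colourCard (colour c P k) P (colour c P k p)) * n =
        (9 / 8) ^ (address c k P p).length * colourCard c P (c p) := by
      intro p hp
      have h₂ : (0 : ℝ) < colourCard (colour c P k) P (colour c P k p) := by
        exact_mod_cast colourCard_pos (colour c P k) hp
      have h₃ : (0 : ℝ) < n := by exact_mod_cast hn ▸ Finset.card_pos.2 ⟨p, hp⟩
      have h₄ : (9 / 8 : ℝ) ^ (address c k P p).length =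
          (3 / 2) ^ (address c k P p).length * (3 / 4) ^ (address c k P p).length := by
        rw [← mul_pow]
        norm_num
      rw [h₄, weight, hn]
      simp only [show (colour c P k p).2 = address c k P p from rfl]
      field_simp
    have h₅ : (n : ℝ) ^ n = ∏ _p ∈ P, (n : ℝ) := by rw [Finset.prod_const, hn]
    rw [hW, hX, hM, hD, ← Finset.prod_pow_eq_pow_sum, h₅, ← Finset.prod_mul_distrib,
      ← Finset.prod_mul_distrib, ← Finset.prod_mul_distrib]
    exact Finset.prod_congr rfl h₁
  have hexp : (n : ℝ) ^ n ≤ Real.exp n * n.factorial := by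
    have := Real.pow_div_factorial_le_exp (n : ℝ) (Nat.cast_nonneg _) n
    rwa [div_le_iff₀ (by positivity)] at this
  have hmain : (9 / 8 : ℝ) ^ D ≤ 2 ^ t * 4 ^ n * Real.exp (9 * n) := by
    refine le_of_mul_le_mul_right ?_ hM0
    calc (9 / 8 : ℝ) ^ D * M = W * X * n ^ n := hWX.symm
      _ ≤ W * X * (Real.exp n * (M * U.card)) := by gcongr; exact hexp.trans (by gcongr)
      _ = U.card * W * X * Real.exp n * M := by ring
      _ ≤ 2 ^ t * 4 ^ n * Real.exp (8 * n) * Real.exp n * M := by gcongr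
      _ = 2 ^ t * 4 ^ n * Real.exp (9 * n) * M := by
          rw [mul_assoc (2 ^ t * 4 ^ n : ℝ), ← Real.exp_add]
          ring_nf
  -- With log(9/8) ≥ 1/9, log 2 ≤ 1 and log 4 ≤ 2 this becomes D/9 ≤ t + 2n + 9n.
  have hlog := Real.log_le_log (by positivity) hmain
  rw [Real.log_mul (by positivity) (by positivity), Real.log_mul (by positivity) (by positivity),
    Real.log_pow, Real.log_pow, Real.log_pow, Real.log_exp] at hlog
  have l₁ : (1 / 9 : ℝ) ≤ Real.log (9 / 8) := by
    have := Real.one_sub_inv_le_log_of_pos (show (0 : ℝ) < 9 / 8 by norm_num)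
    norm_num at this ⊢
    exact this
  have l₂ : Real.log 2 ≤ 1 := by
    have := Real.log_le_sub_one_of_pos (show (0 : ℝ) < 2 by norm_num)
    linarith
  have l₃ : Real.log 4 ≤ 2 := by
    rw [show (4 : ℝ) = 2 ^ 2 by norm_num, Real.log_pow]
    push_cast
    linarith
  have hD0 : (0 : ℝ) ≤ D := Nat.cast_nonneg _
  have ht0 : (0 : ℝ) ≤ t := Nat.cast_nonneg _
  have hn0 : (0 : ℝ) ≤ n := Nat.cast_nonneg _
  have hfin : (D : ℝ) ≤ 9 * t + 99 * n := by
    nlinarith [mul_le_mul_of_nonneg_left l₁ hD0, mul_le_mul_of_nonneg_left l₂ ht0,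
      mul_le_mul_of_nonneg_left l₃ hn0]
  exact_mod_cast hfin

end Weights

/-! ### The classes of a region set -/

section Regions

variable {R : Set (Set Point)}

/-- The points that are equal to `p` or lie in a common region with `p`. -/
def regionClass (R : Set (Set Point)) (p : Point) : Set Point :=
  {q | q = p ∨ ∃ r ∈ R, p ∈ r ∧ q ∈ r}

theorem eq_of_mem_regions (hR : IsRegionSet R) {r r' : Set Point} (hr : r ∈ R) (hr' : r' ∈ R)
    {p : Point} (hp : p ∈ r) (hp' : p ∈ r') : r = r' := by
  by_contra hne
  exact Set.disjoint_left.1 (hR.2 hr hr' hne) hp hp'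

theorem regionClass_eq_iff (hR : IsRegionSet R) {p q : Point} :
    regionClass R p = regionClass R q ↔ p = q ∨ ∃ r ∈ R, p ∈ r ∧ q ∈ r := by
  constructor
  · intro h
    have hp : p ∈ regionClass R q := h ▸ Or.inl rfl
    rcases hp with hp | ⟨r, hr, hq, hp⟩
    · exact Or.inl hp
    · exact Or.inr ⟨r, hr, hp, hq⟩
  · rintro (rfl | ⟨r, hr, hp, hq⟩)
    · rfl
    · have key : ∀ p ∈ r, regionClass R p = r := by
        intro p hp
        ext x
        constructor
        · rintro (rfl | ⟨r', hr', hp', hx⟩)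
          · exact hp
          · rwa [eq_of_mem_regions hR hr hr' hp hp']
        · exact fun hx => Or.inr ⟨r, hr, hp, hx⟩
      rw [key p hp, key q hq]

theorem boxConvex_regionClass (hR : IsRegionSet R) (P : Finset Point) :
    BoxConvex (regionClass R) P := by
  intro a _ b _ d _ hne had h₁ h₂ h₃ h₄
  obtain ⟨r, hr, ha, hd⟩ := ((regionClass_eq_iff hR).1 had).resolve_left hne
  refine (regionClass_eq_iff hR).2 (Or.inr ⟨r, hr, ?_, ha⟩)
  obtain ⟨s, t, hs, ht, rfl⟩ := hR.1 r hr
  exact ⟨hs.out ha.1 hd.1 ⟨h₁.le, h₂.le⟩, ht.out hd.2 ha.2 ⟨h₃.le, h₄.le⟩⟩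

/-- Increasing x is one of the four orders a region may have, so a competitor must be correct on all
these inputs. -/
theorem sortedInputs_subset_universeInputs (hR : IsRegionSet R) {P : Finset Point}
    {I : Input P.card} (h : I ∈ sortedInputs (regionClass R) P.card P) :
    I ∈ universeInputs P R := by
  obtain ⟨h₁, h₂, h₃⟩ := (mem_sortedInputs _).1 h
  exact ⟨h₁, h₂, fun r hr => Or.inl fun i hi j hj hij =>
    h₃ i j hij ((regionClass_eq_iff hR).2 (Or.inr ⟨r, hr, hi, hj⟩))⟩

/-- Two distinct points of one class share a region, and by disjointness that region contains the
whole class; so an unmixed list of at least two points inherits the order of its region. Shorter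
lists are trivially sorted. -/
theorem value_trySorted_of_not_mixed (hR : IsRegionSet R) {n : ℕ} {I : Input n}
    (hI : Function.Injective I) (hres : Respects I R) (l : List (Fin n))
    (hl : l.Pairwise (· < ·)) (h : ¬ Mixed (regionClass R) (points I l)) :
    (trySorted l).value (CoordTest.eval I) = true := by
  rw [value_trySorted]
  rcases l with _ | ⟨i, _ | ⟨j, l⟩⟩
  · simp
  · simp
  have hsame : ∀ a ∈ i :: j :: l, ∀ b ∈ i :: j :: l,
      regionClass R (I a) = regionClass R (I b) := by
    intro a ha b hb
    by_contra hne
    exact h ⟨I a, mem_points.2 ⟨a, ha, rfl⟩, I b, mem_points.2 ⟨b, hb, rfl⟩, hne⟩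
  have hij : i ≠ j := ((List.pairwise_cons.1 hl).1 j (by simp)).ne
  obtain ⟨r, hr, hir, -⟩ := ((regionClass_eq_iff hR).1
    (hsame i (by simp) j (by simp))).resolve_left fun h' => hij (hI h')
  have hmem : ∀ a ∈ i :: j :: l, I a ∈ r := by
    intro a ha
    rcases (regionClass_eq_iff hR).1 (hsame i (by simp) a ha) with h' | ⟨r', hr', hi', ha'⟩
    · rwa [← h']
    · rwa [eq_of_mem_regions hR hr hr' hir hi']
  have chain : ∀ U : Fin n → Fin n → Prop,
      (∀ a, I a ∈ r → ∀ b, I b ∈ r → a < b → U a b) → (i :: j :: l).IsChain U := fun U hU =>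
    (hl.imp_of_mem fun {a b} ha hb hab => hU a (hmem a ha) b (hmem b hb) hab).isChain
  simp only [CoordTest.eval, decide_eq_true_eq]
  rcases hres r hr with h' | h' | h' | h'
  · exact Or.inl (chain _ fun a ha b hb hab => h' ha hb hab)
  · exact Or.inr (Or.inl (chain _ fun a ha b hb hab => h' ha hb hab))
  · exact Or.inr (Or.inr (Or.inl (chain _ fun a ha b hb hab => h' ha hb hab)))
  · exact Or.inr (Or.inr (Or.inr (chain _ fun a ha b hb hab => h' ha hb hab)))

end Regions

/-! ### Universal optimality -/

theorem points_finRange {n : ℕ} {P : Finset Point} {I : Input n} (h : Set.range I = P) :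
    points I (List.finRange n) = P := by
  apply Finset.coe_injective
  rw [← h]
  ext p
  simp [mem_points]

theorem runtime_eppsteinGoodrichIllickanTo_le {P : Finset Point} {R : Set (Set Point)}
    (hP : DistinctCoords (P : Set Point)) (hR : IsRegionSet R) {I : Input P.card}
    (hI : I ∈ universeInputs P R) :
    (eppsteinGoodrichIllickanTo P.card).runtime (CoordTest.eval I) ≤ 8200 * (P.card + 1) +
      6120 * ∑ p ∈ P, (address (regionClass R) P.card P p).length := by
  obtain ⟨hinj, hrange, hres⟩ := hI
  have h₁ := cost_paretoRec_le (regionClass R) hinj (hrange ▸ hP)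
    (value_trySorted_of_not_mixed hR hinj hres) P.card (List.finRange P.card)
    (List.pairwise_lt_finRange _)
  rw [points_finRange hrange, List.length_finRange] at h₁
  have h₂ := mixedSize_le (regionClass R) P.card P hP
  rw [Finset.sum_add_distrib, Finset.sum_const, smul_eq_mul, mul_one] at h₂
  have hmap : (List.finRange P.card).map (Fin.castLE le_rfl) ++ [] = List.finRange P.card := by
    simp
  simp only [Prog.runtime, eppsteinGoodrichIllickanTo, Prog.cost_bind, cost_readInput,
    value_readInput, hmap]
  omega

theorem universallyOptimal_eppsteinGoodrichIllickanTo :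
    eppsteinGoodrichIllickanTo.UniversallyOptimal := by
  -- With n + 1 ≤ t, the bound 8200(n + 1) + 6120(9t + 99n) is below 670000 t.
  refine ⟨1000000, by norm_num, fun P R hgen hR T eval B hB => ?_⟩
  have hP : DistinctCoords (P : Set Point) := hgen.1
  rcases htop : universalTime P R eval B with _ | t
  · exact le_of_le_of_eq le_top (ENat.mul_top (by norm_num)).symm
  have hle : ∀ I ∈ universeInputs P R, B.cost (eval I) + 1 ≤ t := by
    intro I hI
    have h : (B.runtime (eval I) : ℕ∞) ≤ universalTime P R eval B :=
      le_iSup₂ (f := fun I (_ : I ∈ universeInputs P R) => (B.runtime (eval I) : ℕ∞)) I hI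
    rw [htop] at h
    exact Nat.cast_le.1 h
  have hlower := sum_length_address_le (k := P.card) hP (boxConvex_regionClass hR P) rfl eval B t
    (fun I hI => hB I (sortedInputs_subset_universeInputs hR hI))
    fun I hI => (Nat.le_succ _).trans (hle I (sortedInputs_subset_universeInputs hR hI))
  refine iSup₂_le fun I hI => ?_
  have h₁ := runtime_eppsteinGoodrichIllickanTo_le hP hR hI
  have h₂ := Prog.le_cost_of_isSolution B (eval I) I (hB I hI) hI.1
  have h₃ := hle I hI
  have h₄ : (eppsteinGoodrichIllickanTo P.card).runtime (CoordTest.eval I) ≤ 1000000 * t := by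
    omega
  change _ ≤ ((1000000 : ℕ) : ℕ∞) * (t : ℕ∞)
  exact_mod_cast h₄

end ParetoFront

theorem mainTheorem1 :
    ParetoFront.eppsteinGoodrichIllickanTo.Correct ∧
    ParetoFront.eppsteinGoodrichIllickanTo.UniversallyOptimal :=
  ⟨ParetoFront.correct_eppsteinGoodrichIllickanTo,
    ParetoFront.universallyOptimal_eppsteinGoodrichIllickanTo⟩
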